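/- Let $(M,\Omega)$ be a finite-dimensional (Hausdorff, smooth, boundaryless) symplectic manifold, $G$ a finite-dimensional Lie group with Lie algebra $\mathfrak g$ acting smoothly on $M$ and preserving $\Omega$, and $H:M\to\mathbb R$ a smooth $G$-invariant Hamiltonian, with Hamiltonian vector field $X_H$ given by $\Omega(X_H,\cdot)=\mathrm dH$. Let $\mathbf J:M\to\mathfrak g^*$ be a smooth momentum map, $\mathrm d\langle\mathbf J,\xi\rangle=\Omega(\xi_M,\cdot)$, where $\xi_M$ is the infinitesimal generator of $\xi\in\mathfrak g$, equivariant for an affine action $g\cdot\nu=\mathrm{Ad}^*_{g^{-1}}\nu+c(g)$ of $G$ on $\mathfrak g^*$ whose linear part is the coadjoint action (for example $c=0$). Let $x\in M$ lie on a relative equilibrium with finite stabilizer $G_x$: $X_H(x)=\xi_M(x)$ for some $\xi\in\mathfrak g$. Put $\mu=\mathbf J(x)$, let $G_\mu$ be the stabilizer of $\mu$ for the above action on $\mathfrak g^*$, and let $\widehat H=H-\langle\mathbf J,\xi\rangle$ be the augmented Hamiltonian. Assume that the coadjoint action of $G_\mu$ on $\mathfrak g^*$ is bounded, i.e. for all $\nu\in\mathfrak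 g^*$, $\eta\in\mathfrak g$ the function $g\mapsto\langle\mathrm{Ad}^*_{g^{-1}}\nu,\eta\rangle$ is bounded on $G_\mu$ (automatic if $G$, or only $G_\mu$, is compact). Let $T_0=\mathfrak g\cdot x\cap\operatorname{Ker}\mathrm d\mathbf J(x)$ and let the symplectic slice $\mathcal N$ be any $G_x$-invariant complement to $T_0$ in $\operatorname{Ker}\mathrm d\mathbf J(x)$. Restrict $\widehat H$ to the slice as follows: let $\varphi$ be a smooth map from a neighbourhood of $0$ in a normed vector space $W$ to the level set $\mathbf J^{-1}(\mu)$, with $\varphi(0)=x$ and $\mathrm d\varphi(0)$ a linear isomorphism of $W$ onto $\mathcal N$, and let $f=\widehat H\circ\varphi-\widehat H(x)$. Write $B=\mathrm d^2f(0)$, $C=\mathrm d^3f(0)$, $D=\mathrm d^4f(0)$. (Here $f(0)=0$ and $\mathrm df(0)=0$.) Suppose that $B$ is positive semidefinite and that for all $\mathbf a\in\operatorname{Ker}B\setminus\{0\}$ and all $\mathbf b\in W$ $$C\mathbf a^3=0,\qquad D\mathbf a^4+6\,C\mathbf a^2\mathbf b+3\,B\mathbf b^2>0 .$$ Then the relative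 equilibrium is Lyapunov stable in terms of $G_\mu$-invariant sets: the trajectory of $X_H$ through $x$ exists for all time, and for every $G_\mu$-invariant neighbourhood $V$ of this trajectory there is a $G_\mu$-invariant open neighbourhood $U\subseteq V$ of it such that every trajectory of $X_H$ starting in $U$ exists for all time and remains in $V$ for all time. -/

import Mathlib

open Set Filter Topology
open scoped Manifold ContDiff

noncomputable section

namespace HamSym

/-! ### Fourth-order positivity conditions at a critical point -/

section Probe

variable {W : Type*} [NormedAddCommGroup W] [NormedSpace ℝ W]

/-- Fourth-order conditions on a function `f` near `0`, with `B = d²f(0)`, `C = d³f(0)`,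
`D = d⁴f(0)`: the value and the first derivative vanish at `0`, `B` is positive semidefinite, and
for all nonzero `a ∈ Ker B` and all `b` one has `C a³ = 0` and `D a⁴ + 6 C a² b + 3 B b² > 0`. -/
structure ProbeConditions (f : W → ℝ) : Prop where
  contDiffAt : ContDiffAt ℝ 4 f 0
  map_zero : f 0 = 0
  critical : fderiv ℝ f 0 = 0
  posSemidef : ∀ v : W, 0 ≤ iteratedFDeriv ℝ 2 f 0 ![v, v]
  cubic : ∀ a : W, (∀ w : W, iteratedFDeriv ℝ 2 f 0 ![a, w] = 0) → a ≠ 0 →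
    iteratedFDeriv ℝ 3 f 0 ![a, a, a] = 0
  quartic : ∀ a : W, (∀ w : W, iteratedFDeriv ℝ 2 f 0 ![a, w] = 0) → a ≠ 0 → ∀ b : W,
    0 < iteratedFDeriv ℝ 4 f 0 ![a, a, a, a] + 6 * iteratedFDeriv ℝ 3 f 0 ![a, a, b]
      + 3 * iteratedFDeriv ℝ 2 f 0 ![b, b]

end Probe

/-! ### Symplectic manifolds and Hamiltonian vector fields

Manifolds are finite-dimensional, smooth and without boundary; they are modelled on a
normed space `E`. -/

section Symplectic

variable {E : Type*} [NormedAddCommGroup E] [NormedSpace ℝ E]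
  {M : Type*} [TopologicalSpace M] [ChartedSpace E M]

/-- The expression, in the preferred chart at `x₀`, of a field of alternating 2-forms on `M`: a
2-form on the model space (meaningful on the target of the chart). -/
def chartForm (Ω : (x : M) → (TangentSpace 𝓘(ℝ, E) x) [⋀^Fin 2]→L[ℝ] ℝ) (x₀ : M) (u : E) :
    E [⋀^Fin 2]→L[ℝ] ℝ :=
  (Ω ((chartAt E x₀).symm u)).compContinuousLinearMap
    (mfderiv 𝓘(ℝ, E) 𝓘(ℝ, E) (chartAt E x₀).symm u)

variable (E M) in
/-- A symplectic form: a smooth, closed, nondegenerate 2-form. -/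
structure SymplecticForm where
  /-- the value of the form at each point -/
  form : (x : M) → (TangentSpace 𝓘(ℝ, E) x) [⋀^Fin 2]→L[ℝ] ℝ
  smooth : ∀ x₀ : M, ContDiffOn ℝ ∞ (chartForm form x₀) (chartAt E x₀).target
  closed : ∀ x₀ : M, ∀ u ∈ (chartAt E x₀).target, extDeriv (chartForm form x₀) u = 0
  nondegenerate : ∀ (x : M) (v : TangentSpace 𝓘(ℝ, E) x),
    (∀ w : TangentSpace 𝓘(ℝ, E) x, form x ![v, w] = 0) → v = 0

/-- The differential of a real function at a point, as a linear form on the tangent space. -/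
def differential (H : M → ℝ) (x : M) : TangentSpace 𝓘(ℝ, E) x →L[ℝ] ℝ :=
  mfderiv 𝓘(ℝ, E) 𝓘(ℝ, ℝ) H x

theorem SymplecticForm.exists_unique_dual [FiniteDimensional ℝ E] (Ω : SymplecticForm E M) (x : M)
    (α : TangentSpace 𝓘(ℝ, E) x →L[ℝ] ℝ) :
    ∃! v : TangentSpace 𝓘(ℝ, E) x, ∀ w : TangentSpace 𝓘(ℝ, E) x, Ω.form x ![v, w] = α w := by
  have : FiniteDimensional ℝ (TangentSpace 𝓘(ℝ, E) x) := inferInstanceAs (FiniteDimensional ℝ E)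
  have e0 (a b c : TangentSpace 𝓘(ℝ, E) x) : Function.update ![a, b] 0 c = ![c, b] := by
    funext i; fin_cases i <;> rfl
  have e1 (a b c : TangentSpace 𝓘(ℝ, E) x) : Function.update ![a, b] 1 c = ![a, c] := by
    funext i; fin_cases i <;> rfl
  let B : TangentSpace 𝓘(ℝ, E) x →ₗ[ℝ] Module.Dual ℝ (TangentSpace 𝓘(ℝ, E) x) :=
    LinearMap.mk₂ ℝ (fun v w => Ω.form x ![v, w])
      (fun v v' w => by
        have := (Ω.form x).map_update_add ![v, w] 0 v v'
        rwa [e0, e0, e0] at this)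
      (fun c v w => by
        have := (Ω.form x).map_update_smul ![v, w] 0 c v
        rwa [e0, e0] at this)
      (fun v w w' => by
        have := (Ω.form x).map_update_add ![v, w] 1 w w'
        rwa [e1, e1, e1] at this)
      (fun c v w => by
        have := (Ω.form x).map_update_smul ![v, w] 1 c w
        rwa [e1, e1] at this)
  have hB : Function.Injective B := by
    rw [← LinearMap.ker_eq_bot, LinearMap.ker_eq_bot']
    intro v hv
    exact Ω.nondegenerate x v fun w => LinearMap.congr_fun hv w
  have hs : Function.Surjective B :=
    (LinearMap.injective_iff_surjective_of_finrank_eq_finrank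
      Subspace.dual_finrank_eq.symm).1 hB
  obtain ⟨v, hv⟩ := hs α.toLinearMap
  refine ⟨v, fun w => LinearMap.congr_fun hv w, fun v' hv' => hB ?_⟩
  rw [hv]
  exact LinearMap.ext hv'

/-- The Hamiltonian vector field `X_H`, defined by `Ω(X_H, ·) = dH`. -/
def SymplecticForm.hamVF [FiniteDimensional ℝ E] (Ω : SymplecticForm E M) (H : M → ℝ) (x : M) :
    TangentSpace 𝓘(ℝ, E) x :=
  (Ω.exists_unique_dual x (differential H x)).choose

theorem SymplecticForm.form_hamVF [FiniteDimensional ℝ E] (Ω : SymplecticForm E M) (H : M → ℝ)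
    (x : M) (w : TangentSpace 𝓘(ℝ, E) x) :
    Ω.form x ![Ω.hamVF H x, w] = differential H x w :=
  (Ω.exists_unique_dual x (differential H x)).choose_spec.1 w

end Symplectic

/-! ### Symmetries, momentum maps, augmented Hamiltonians -/

section Symmetry

variable {E : Type*} [NormedAddCommGroup E] [NormedSpace ℝ E]
  {M : Type*} [TopologicalSpace M] [ChartedSpace E M]
  {F : Type*} [NormedAddCommGroup F] [NormedSpace ℝ F]
  {G : Type*} [TopologicalSpace G] [ChartedSpace F G] [Group G] [MulAction G M]

variable (F G) in
/-- The Lie algebra `𝔤 = T₁G` of `G`. -/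
abbrev LieAlg : Type _ := GroupLieAlgebra 𝓘(ℝ, F) G

variable (F G) in
/-- The dual `𝔤*` of the (finite-dimensional) Lie algebra. -/
abbrev LieDual : Type _ := Module.Dual ℝ (LieAlg F G)

/-- The adjoint representation: the derivative at `1` of `h ↦ g h g⁻¹`. -/
def Ad (g : G) : LieAlg F G →L[ℝ] LieAlg F G :=
  mfderiv 𝓘(ℝ, F) 𝓘(ℝ, F) (fun h : G => g * h * g⁻¹) 1

/-- The coadjoint representation: `⟨coAd g ν, ξ⟩ = ⟨ν, Ad g⁻¹ ξ⟩`. -/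
def coAd (g : G) (ν : LieDual F G) : LieDual F G :=
  ν.comp (Ad (F := F) g⁻¹).toLinearMap

/-- The infinitesimal action at `x`: `ξ ↦ ξ_M(x)`, the derivative at `1` of `g ↦ g • x`. -/
def infAction (x : M) : LieAlg F G →L[ℝ] TangentSpace 𝓘(ℝ, E) x :=
  mfderiv 𝓘(ℝ, F) 𝓘(ℝ, E) (fun g : G => g • x) 1

/-- The derivative at `y` of the transformation `y ↦ g • y`. -/
def tangentMap (g : G) (y : M) :
    TangentSpace 𝓘(ℝ, E) y →L[ℝ] TangentSpace 𝓘(ℝ, E) (g • y) :=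
  mfderiv 𝓘(ℝ, E) 𝓘(ℝ, E) (fun z : M => g • z) y

/-- `G` acts by transformations that preserve the symplectic form. -/
def IsSymplecticAction (G : Type*) [TopologicalSpace G] [Group G] [MulAction G M]
    (Ω : SymplecticForm E M) : Prop :=
  ∀ (g : G) (y : M) (v w : TangentSpace 𝓘(ℝ, E) y),
    Ω.form (g • y) ![tangentMap g y v, tangentMap g y w] = Ω.form y ![v, w]

variable (F G) in
/-- A momentum map `J : M → 𝔤*` for the action of `G`: smooth, with `d⟨J, ξ⟩ = Ω(ξ_M, ·)`, and
equivariant for an affine action `ν ↦ coAd g ν + c g` of `G` on `𝔤*` whose linear part is the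
coadjoint action; `c = 0` gives the coadjoint-equivariant momentum maps. -/
structure MomentumMap (Ω : SymplecticForm E M) where
  /-- the momentum map itself -/
  J : M → LieDual F G
  /-- the cocycle of the affine action -/
  c : G → LieDual F G
  smooth : ∀ ξ : LieAlg F G, ContMDiff 𝓘(ℝ, E) 𝓘(ℝ, ℝ) ∞ (fun y => J y ξ)
  hamiltonian : ∀ (ξ : LieAlg F G) (y : M) (w : TangentSpace 𝓘(ℝ, E) y),
    Ω.form y ![infAction y ξ, w] = differential (fun z => J z ξ) y w
  cocycle : ∀ g h : G, c (g * h) = coAd g (c h) + c g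
  equivariant : ∀ (g : G) (y : M), J (g • y) = coAd g (J y) + c g

variable {Ω : SymplecticForm E M}

/-- The stabilizer `G_μ` of `μ ∈ 𝔤*` for the action on `𝔤*` that makes `J` equivariant. -/
def MomentumMap.isotropy (P : MomentumMap F G Ω) (μ : LieDual F G) : Set G :=
  {g | coAd g μ + P.c g = μ}

/-- The augmented Hamiltonian `H - ⟨J, ξ⟩`. -/
def MomentumMap.augmented (P : MomentumMap F G Ω) (H : M → ℝ) (ξ : LieAlg F G) (y : M) : ℝ :=
  H y - P.J y ξ

/-- `Ker dJ(x)`. -/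
def MomentumMap.kerD (P : MomentumMap F G Ω) (x : M) : Submodule ℝ (TangentSpace 𝓘(ℝ, E) x) :=
  ⨅ ξ : LieAlg F G, (differential (fun z => P.J z ξ) x).toLinearMap.ker

/-- `T₀ = 𝔤·x ∩ Ker dJ(x)`. -/
def MomentumMap.orbitKer (P : MomentumMap F G Ω) (x : M) :
    Submodule ℝ (TangentSpace 𝓘(ℝ, E) x) :=
  (infAction (F := F) (G := G) x).toLinearMap.range ⊓ P.kerD x

/-- `N` is a symplectic slice at `x`: a `G_x`-invariant complement to `T₀` in `Ker dJ(x)`. For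
`g ∈ G_x` the map `tangentMap g x` goes from the tangent space at `x` to the one at `g • x = x`. -/
structure MomentumMap.IsSymplecticSlice (P : MomentumMap F G Ω) (x : M)
    (N : Submodule ℝ (TangentSpace 𝓘(ℝ, E) x)) : Prop where
  sup_eq : P.orbitKer x ⊔ N = P.kerD x
  inf_eq : P.orbitKer x ⊓ N = ⊥
  invariant : ∀ (g : G) (hg : g • x = x), ∀ v ∈ N, hg ▸ tangentMap g x v ∈ N

/-- `φ`, defined near `0` in `W`, parametrizes a submanifold through `x = φ 0` of the momentum level
set `J⁻¹(J x)` whose tangent space at `x` is `N`; its derivative at `0` identifies `W` with `N`. -/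
structure MomentumMap.IsSliceParametrization {W : Type*} [NormedAddCommGroup W] [NormedSpace ℝ W]
    (P : MomentumMap F G Ω) (x : M) (N : Submodule ℝ (TangentSpace 𝓘(ℝ, E) x)) (φ : W → M) :
    Prop where
  map_zero : φ 0 = x
  smooth : ContMDiffAt 𝓘(ℝ, W) 𝓘(ℝ, E) ∞ φ 0
  momentum : ∀ᶠ v in 𝓝 (0 : W), P.J (φ v) = P.J x
  tangent : ∃ L : W →L[ℝ] TangentSpace 𝓘(ℝ, E) x, Function.Injective L ∧
    L.toLinearMap.range = N ∧ map_zero ▸ mfderiv 𝓘(ℝ, W) 𝓘(ℝ, E) φ 0 = L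

/-- `V` is invariant under the transformations that belong to the set `K ⊆ G`. -/
def IsInvariantUnder (K : Set G) (V : Set M) : Prop :=
  ∀ g ∈ K, ∀ y ∈ V, g • y ∈ V

/-- Lyapunov stability, relative to `K ⊆ G`, of the trajectory through `x` of the vector field `X`.
The trajectory `γ₀` exists for all time, and each `K`-invariant neighbourhood `V` of it contains a
`K`-invariant open neighbourhood `U` of it such that the trajectories that start in `U` exist for
all time and remain in `V` for all time. -/
def IsLyapunovStable (K : Set G) (X : (y : M) → TangentSpace 𝓘(ℝ, E) y) (x : M) : Prop :=
  ∃ γ₀ : ℝ → M, γ₀ 0 = x ∧ IsMIntegralCurve γ₀ X ∧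
    ∀ V : Set M, V ∈ 𝓝ˢ (range γ₀) → IsInvariantUnder K V →
      ∃ U : Set M, U ⊆ V ∧ IsOpen U ∧ range γ₀ ⊆ U ∧ IsInvariantUnder K U ∧
        (∀ y ∈ U, ∃ γ : ℝ → M, γ 0 = y ∧ IsMIntegralCurve γ X) ∧
        ∀ γ : ℝ → M, IsMIntegralCurve γ X → γ 0 ∈ U → ∀ t : ℝ, γ t ∈ V

end Symmetry

end HamSym

end

/-! The fourth-order conditions give the augmented Hamiltonian a strict local minimum at `x` along
the slice (`ProbeConditions.eventually_pos`). Scaling Ker B by r and a complement by r² kills every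
Taylor term of order below r⁴, and the coefficient of r⁴ is positive on a compact sphere.

Thicken the slice by a complement of Ker dJ(x) to a section `σ` through `x`. The directions in T₀
are tangent to curves k(t)·x with k(t) in G_μ, so the G_μ-translates of σ(B) fill a neighbourhood of
`x` for each neighbourhood B of 0 (`MomentumMap.isotropy_smul_mem_nhds`). Near `x` the section meets
the level set of J only in the slice, so `x` is its only point there with J = μ and augmented
Hamiltonian at most the value at `x` (`MomentumMap.exists_slice_section`).

The flow conserves H and J. If y = k·z with k in G_μ and z on the section, then H(z) = H(y), and
J(z) - μ is the image of J(y) - μ under the coadjoint action of k⁻¹. Boundedness of that action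
controls J(z) - μ uniformly in k. Hence a conserved quantity of y, small near `x`, forces z to be
close to `x`, even off the level set J = μ. The trajectory therefore stays in the G_μ-saturation of
a small piece of the section. Translating back by k⁻¹ gives a uniform existence time, so
completeness and confinement come together (`MomentumMap.exists_confined_integralCurves`).
`isLyapunovStable_of_saturation` turns this into stability. -/

noncomputable section

namespace HamSym

/-! ### Symmetry of second and third derivatives -/

section Multilinear

variable {W : Type*} [NormedAddCommGroup W] [NormedSpace ℝ W]

theorem map_vec2_add_left (B : W [×2]→L[ℝ] ℝ) (x x' y : W) :
    B ![x + x', y] = B ![x, y] + B ![x', y] :=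
  B.cons_add ![y] x x'

theorem map_vec2_smul_left (B : W [×2]→L[ℝ] ℝ) (c : ℝ) (x y : W) :
    B ![c • x, y] = c * B ![x, y] :=
  B.cons_smul ![y] c x

theorem map_vec3_add_left (C : W [×3]→L[ℝ] ℝ) (x x' y z : W) :
    C ![x + x', y, z] = C ![x, y, z] + C ![x', y, z] :=
  C.cons_add ![y, z] x x'

theorem map_vec3_smul_left (C : W [×3]→L[ℝ] ℝ) (c : ℝ) (x y z : W) :
    C ![c • x, y, z] = c * C ![x, y, z] :=
  C.cons_smul ![y, z] c x

theorem iteratedFDeriv_two_swap {V : Type*} [NormedAddCommGroup V] [NormedSpace ℝ V] {f : W → V}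
    {p : W} (hf : ContDiffAt ℝ 2 f p) (x y : W) :
    iteratedFDeriv ℝ 2 f p ![x, y] = iteratedFDeriv ℝ 2 f p ![y, x] := by
  have h : IsSymmSndFDerivAt ℝ f p := hf.isSymmSndFDerivAt (by simp)
  rw [iteratedFDeriv_two_apply, iteratedFDeriv_two_apply]
  exact h.eq x y

/-- Symmetry of the second derivative of `fderiv ℝ f`. Together with the other adjacent swap, proved
next, this gives full symmetry of the third derivative. -/
theorem iteratedFDeriv_three_swap_left {f : W → ℝ} {p : W} (hf : ContDiffAt ℝ 3 f p) (x y z : W) :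
    iteratedFDeriv ℝ 3 f p ![x, y, z] = iteratedFDeriv ℝ 3 f p ![y, x, z] := by
  have h1 (x y : W) : iteratedFDeriv ℝ 3 f p ![x, y, z]
      = iteratedFDeriv ℝ 2 (fderiv ℝ f) p ![x, y] z := by
    rw [iteratedFDeriv_succ_apply_right]
    congr 2
    funext i; fin_cases i <;> rfl
  rw [h1, h1, iteratedFDeriv_two_swap (hf.fderiv_right (m := 2) (by norm_num))]

/-- Here the symmetry of the second derivative of `f`, valid on a neighbourhood of `p`, is itself
differentiated. -/
theorem iteratedFDeriv_three_swap_right {f : W → ℝ} {p : W} (hf : ContDiffAt ℝ 3 f p)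
    (x y z : W) :
    iteratedFDeriv ℝ 3 f p ![x, y, z] = iteratedFDeriv ℝ 3 f p ![x, z, y] := by
  have hd : DifferentiableAt ℝ (iteratedFDeriv ℝ 2 f) p :=
    hf.differentiableAt_iteratedFDeriv (by norm_cast)
  have h1 (y z : W) : iteratedFDeriv ℝ 3 f p ![x, y, z]
      = fderiv ℝ (fun q => iteratedFDeriv ℝ 2 f q ![y, z]) p x := by
    rw [iteratedFDeriv_succ_apply_left, fderiv_continuousMultilinear_apply_const_apply hd]
    rfl
  rw [h1, h1]
  congr 1
  apply Filter.EventuallyEq.fderiv_eq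
  have : ∀ᶠ q in 𝓝 p, ContDiffAt ℝ 3 f q := hf.eventually (by norm_cast)
  filter_upwards [this] with q hq
  exact iteratedFDeriv_two_swap (hq.of_le (by norm_cast)) y z

end Multilinear

/-! ### Taylor's formula of order four -/

section Taylor

variable {W : Type*} [NormedAddCommGroup W] [NormedSpace ℝ W]

/-- Fourth-order Taylor lower bound with Peano remainder. -/
theorem eventually_taylor_four_le {f : W → ℝ} (hf : ContDiffAt ℝ 4 f 0) {ε : ℝ} (hε : 0 < ε) :
    ∀ᶠ v in 𝓝 (0 : W),
      f 0 + fderiv ℝ f 0 v + 2⁻¹ * iteratedFDeriv ℝ 2 f 0 ![v, v]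
        + 6⁻¹ * iteratedFDeriv ℝ 3 f 0 ![v, v, v]
        + 24⁻¹ * iteratedFDeriv ℝ 4 f 0 ![v, v, v, v] - ε * ‖v‖ ^ 4 ≤ f v := by
  have h1 : ∀ᶠ v in 𝓝 (0 : W), ContDiffAt ℝ 4 f v := hf.eventually (by norm_cast)
  have hc : ContinuousAt (iteratedFDeriv ℝ 4 f) 0 := hf.continuousAt_iteratedFDeriv (by norm_cast)
  have h2 := Metric.continuousAt_iff'.1 hc ε hε
  obtain ⟨r, hr, hball⟩ := Metric.eventually_nhds_iff_ball.1 (h1.and h2)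
  filter_upwards [Metric.ball_mem_nhds (0 : W) hr] with v hv
  have hmem : ∀ t ∈ Icc (0 : ℝ) 1, t • v ∈ Metric.ball (0 : W) r := by
    intro t ht
    rw [mem_ball_zero_iff] at hv ⊢
    rw [norm_smul, Real.norm_eq_abs, abs_of_nonneg ht.1]
    nlinarith [ht.1, ht.2, norm_nonneg v]
  have key := map_add_eq_sum_add_integral_iteratedFDeriv (n := 3) (f := f) (x := 0) (y := v)
    (fun t ht => by
      rw [zero_add]
      exact_mod_cast (hball _ (hmem t ht)).1)
  simp only [zero_add, Nat.reduceAdd, Finset.sum_range_succ, Finset.range_zero, Finset.sum_empty,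
    Nat.factorial, iteratedFDeriv_zero_apply, iteratedFDeriv_one_apply] at key
  have e2 : ![v, v] = fun _ => v := by funext i; fin_cases i <;> rfl
  have e3 : ![v, v, v] = fun _ => v := by funext i; fin_cases i <;> rfl
  have e4 : ![v, v, v, v] = fun _ => v := by funext i; fin_cases i <;> rfl
  have hcont : ContinuousOn
      (fun t : ℝ => (1 - t) ^ 3 • iteratedFDeriv ℝ 4 f (t • v) (fun _ => v)) (uIcc 0 1) := by
    intro t ht
    rw [uIcc_of_le zero_le_one] at ht
    have hca : ContinuousAt (iteratedFDeriv ℝ 4 f) (t • v) :=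
      (hball _ (hmem t ht)).1.continuousAt_iteratedFDeriv (by norm_cast)
    have hc1 : ContinuousAt (fun s : ℝ => iteratedFDeriv ℝ 4 f (s • v)) t :=
      ContinuousAt.comp (f := fun s : ℝ => s • v) hca
        (continuous_id.smul continuous_const).continuousAt
    have hc2 : ContinuousAt (fun s : ℝ => iteratedFDeriv ℝ 4 f (s • v) (fun _ => v)) t :=
      (ContinuousMultilinearMap.apply ℝ (fun _ : Fin 4 => W) ℝ
        (fun _ => v)).continuous.continuousAt.comp hc1
    have hc3 : ContinuousAt (fun s : ℝ => (1 - s) ^ 3) t := by fun_prop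
    exact (hc3.smul hc2).continuousWithinAt
  -- The fourth derivative at `t • v`, applied to `v`, is bounded below by its value at 0 minus
  -- ε‖v‖⁴. The weight (1 - t)³ integrates to 1/4, which with the factor 1/3! yields the coefficient
  -- 1/24. The error is then ε/24, and ε is used as a cruder bound.
  have hint : ∫ t in (0 : ℝ)..1, (1 - t) ^ 3 • (iteratedFDeriv ℝ 4 f 0 (fun _ => v) - ε * ‖v‖ ^ 4)
      = 4⁻¹ * (iteratedFDeriv ℝ 4 f 0 (fun _ => v) - ε * ‖v‖ ^ 4) := by
    rw [intervalIntegral.integral_smul_const]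
    have : ∫ t in (0 : ℝ)..1, (1 - t) ^ 3 = 4⁻¹ := by
      rw [intervalIntegral.integral_comp_sub_left (fun t : ℝ => t ^ 3)]
      norm_num
    rw [this, smul_eq_mul]
  have hle : ∫ t in (0 : ℝ)..1, (1 - t) ^ 3 • (iteratedFDeriv ℝ 4 f 0 (fun _ => v) - ε * ‖v‖ ^ 4)
      ≤ ∫ t in (0 : ℝ)..1, (1 - t) ^ 3 • iteratedFDeriv ℝ 4 f (t • v) (fun _ => v) := by
    apply intervalIntegral.integral_mono_on zero_le_one
    · apply Continuous.intervalIntegrable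
      fun_prop
    · exact hcont.intervalIntegrable
    · intro t ht
      apply smul_le_smul_of_nonneg_left _ (pow_nonneg (by linarith [ht.2]) 3)
      have hd := (hball _ (hmem t ht)).2
      rw [dist_eq_norm] at hd
      have hb := (iteratedFDeriv ℝ 4 f (t • v) - iteratedFDeriv ℝ 4 f 0).le_opNorm (fun _ => v)
      rw [_root_.sub_apply, Real.norm_eq_abs, Finset.prod_const,
        Finset.card_univ, Fintype.card_fin] at hb
      have := abs_le.1 hb
      have h4 : 0 ≤ ‖v‖ ^ 4 := by positivity
      nlinarith [this.1]
  have h4 : 0 ≤ ‖v‖ ^ 4 := by positivity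
  rw [hint] at hle
  rw [key, e4, e3, e2]
  norm_num at hle ⊢
  nlinarith

end Taylor

/-! ### Strict local minimum from the fourth-order conditions -/

section Minimum

variable {W : Type*} [NormedAddCommGroup W] [NormedSpace ℝ W] [FiniteDimensional ℝ W]

/-- In the splitting v = r a + r² b with a in Ker B and b in a complement, the Taylor polynomial of
degree four is r⁴ times a function `Q r (a, b)` continuous in all variables: Ba = 0 and Ca³ = 0
remove the lower powers. At r = 0 it equals (D a⁴ + 12 C a²b + 12 B b²)/24, positive for (a, b) ≠ 0.
Compactness of the unit sphere makes this uniform for small r. -/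
theorem ProbeConditions.eventually_pos {f : W → ℝ} (hf : ProbeConditions f) :
    ∀ᶠ v in 𝓝 (0 : W), v ≠ 0 → 0 < f v := by
  set B := iteratedFDeriv ℝ 2 f 0 with hB
  set C := iteratedFDeriv ℝ 3 f 0 with hC
  set D := iteratedFDeriv ℝ 4 f 0 with hD
  have hf3 : ContDiffAt ℝ 3 f 0 := hf.contDiffAt.of_le (by norm_cast)
  have hf2 : ContDiffAt ℝ 2 f 0 := hf.contDiffAt.of_le (by norm_cast)
  have Bs (x y : W) : B ![x, y] = B ![y, x] := iteratedFDeriv_two_swap hf2 x y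
  have Cs1 (x y z : W) : C ![x, y, z] = C ![y, x, z] := iteratedFDeriv_three_swap_left hf3 x y z
  have Cs2 (x y z : W) : C ![x, y, z] = C ![x, z, y] := iteratedFDeriv_three_swap_right hf3 x y z
  let K : Submodule ℝ W :=
    { carrier := {a | ∀ w, B ![a, w] = 0}
      add_mem' := fun {a b} ha hb w => by rw [map_vec2_add_left, ha, hb, add_zero]
      zero_mem' := fun w => by
        have := map_vec2_smul_left B 0 0 w
        rwa [zero_smul, zero_mul] at this
      smul_mem' := fun c a ha w => by rw [map_vec2_smul_left, ha, mul_zero] }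
  obtain ⟨S, hS⟩ := K.exists_isCompl
  -- positive semidefiniteness gives positivity on the complement
  have Bquad (x y : W) (t : ℝ) : B ![t • x + y, t • x + y]
      = t ^ 2 * B ![x, x] + 2 * t * B ![x, y] + B ![y, y] := by
    rw [map_vec2_add_left, map_vec2_smul_left, Bs x, Bs y, map_vec2_add_left, map_vec2_add_left,
      map_vec2_smul_left, map_vec2_smul_left, Bs y x]
    ring
  have Bpos (b : W) (hb : b ∈ S) (hb0 : b ≠ 0) : 0 < B ![b, b] := by
    refine lt_of_le_of_ne (hf.posSemidef b) fun h0 => hb0 ?_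
    have hbK : b ∈ K := by
      intro w
      by_contra hw
      -- If B(b,b) = 0 and B(b,w) ≠ 0, this multiple of b makes the quadratic form at the sum equal
      -- to -1.
      have h1 := hf.posSemidef ((-(B ![w, w] + 1) / (2 * B ![b, w])) • b + w)
      have h2 : 2 * (-(B ![w, w] + 1) / (2 * B ![b, w])) * B ![b, w] = -(B ![w, w] + 1) := by
        field_simp
      rw [← hB, Bquad, ← h0, h2] at h1
      linarith
    exact Submodule.disjoint_def.1 hS.disjoint b hbK hb
  let Q : ℝ → K × S → ℝ := fun r p =>
    2⁻¹ * B ![(p.2 : W), (p.2 : W)] + 6⁻¹ * (3 * C ![(p.1 : W), (p.1 : W), (p.2 : W)]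
      + r * (3 * C ![(p.1 : W), (p.2 : W), (p.2 : W)]) +
        r ^ 2 * C ![(p.2 : W), (p.2 : W), (p.2 : W)])
      + 24⁻¹ * D ![(p.1 + r • p.2 : W), (p.1 + r • p.2 : W), (p.1 + r • p.2 : W),
        (p.1 + r • p.2 : W)]
  have hQc : Continuous (fun x : ℝ × (K × S) => Q x.1 x.2) := by
    have c2 {f g : ℝ × (K × S) → W} (hf : Continuous f) (hg : Continuous g) :
        Continuous fun x => B ![f x, g x] :=
      B.cont.comp (continuous_pi fun i => by fin_cases i <;> assumption)
    have c3 {f g h : ℝ × (K × S) → W} (hf : Continuous f) (hg : Continuous g) (hh : Continuous h) :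
        Continuous fun x => C ![f x, g x, h x] :=
      C.cont.comp (continuous_pi fun i => by fin_cases i <;> assumption)
    have c4 {f : ℝ × (K × S) → W} (hf : Continuous f) :
        Continuous fun x => D ![f x, f x, f x, f x] :=
      D.cont.comp (continuous_pi fun i => by fin_cases i <;> assumption)
    have ha : Continuous fun x : ℝ × (K × S) => (x.2.1 : W) := by fun_prop
    have hb : Continuous fun x : ℝ × (K × S) => (x.2.2 : W) := by fun_prop
    have hab : Continuous fun x : ℝ × (K × S) => (x.2.1 + x.1 • x.2.2 : W) := by fun_prop
    exact ((continuous_const.mul (c2 hb hb)).add (continuous_const.mul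
      (((continuous_const.mul (c3 ha ha hb)).add
        (continuous_fst.mul (continuous_const.mul (c3 ha hb hb)))).add
          ((continuous_fst.pow 2).mul (c3 hb hb hb))))).add (continuous_const.mul (c4 hab))
  have hQ0 : ∀ p ∈ Metric.sphere (0 : K × S) 1, 0 < Q 0 p := by
    rintro ⟨a, b⟩ hp
    have hne : (a, b) ≠ 0 := by
      rintro h
      rw [h] at hp; simp at hp
    simp only [Q, zero_smul, add_zero, zero_mul, ne_eq, OfNat.ofNat_ne_zero, not_false_eq_true,
      zero_pow]
    by_cases ha : a = 0
    · have hb : b ≠ 0 := fun hb => hne (by rw [ha, hb]; rfl)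
      have h1 := Bpos b b.2 (by simpa using hb)
      have h2 : C ![(a : W), (a : W), (b : W)] = 0 := C.map_coord_zero 0 (by simp [ha])
      have h3 : D ![(a : W), (a : W), (a : W), (a : W)] = 0 := D.map_coord_zero 0 (by simp [ha])
      rw [h2, h3]
      linarith
    -- With 2b in place of b, the hypothesis has coefficients 1, 12, 12: exactly 24 times `Q 0 (a,
    -- b)`.
    · have h1 := hf.quartic a a.2 (by simpa using ha) ((2 : ℝ) • (b : W))
      rw [← hB, ← hC, ← hD, map_vec2_smul_left, Bs, map_vec2_smul_left, Cs2, Cs1,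
        map_vec3_smul_left, Cs1, Cs2] at h1
      linarith
  have hcomp : IsCompact (Metric.sphere (0 : K × S) 1) := isCompact_sphere _ _
  obtain ⟨q, hq, hQq⟩ : ∃ q > 0, ∀ᶠ r in 𝓝 (0 : ℝ), ∀ p ∈ Metric.sphere (0 : K × S) 1,
      q < Q r p := by
    obtain ⟨q, hq, hmin⟩ := hcomp.exists_forall_le' (f := Q 0) (a := 0)
      (hQc.comp (Continuous.prodMk_right 0)).continuousOn hQ0
    refine ⟨q / 2, half_pos hq, hcomp.eventually_forall_of_forall_eventually fun p hp => ?_⟩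
    exact hQc.continuousAt.eventually (lt_mem_nhds (show q / 2 < Q 0 p by linarith [hmin p hp]))
  let e : (K × S) ≃L[ℝ] W := (K.prodEquivOfIsCompl S hS).toContinuousLinearEquiv
  have he (p : K × S) : e p = p.1 + p.2 := rfl
  -- The gauge that is homogeneous for the weights 1 on Ker B and 2 on the complement. Dividing the
  -- components by ρ and ρ² puts the pair on the unit sphere of the sup norm.
  let ρ : W → ℝ := fun v => max ‖(e.symm v).1‖ √‖(e.symm v).2‖
  have hρ : Tendsto ρ (𝓝 0) (𝓝 0) := by
    have : Continuous ρ := by fun_prop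
    simpa [ρ] using this.tendsto 0
  -- For r < 1 one has ‖v‖ ≤ 2r, so the remainder is at most (q/32)·16 r⁴ = q r⁴/2, half of the
  -- lower bound q r⁴ for the main part.
  filter_upwards [eventually_taylor_four_le hf.contDiffAt (ε := q / 32) (by positivity),
    hρ.eventually hQq, hρ.eventually (gt_mem_nhds one_pos)] with v hT hQ h1 hv
  set r := ρ v with hr
  set a := (e.symm v).1 with ha
  set b := (e.symm v).2 with hb
  have hab : v = a + b := by rw [← he (a, b), ha, hb, Prod.mk.eta, e.apply_symm_apply]
  have hra : ‖a‖ ≤ r := le_max_left _ _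
  have hrb' : √‖b‖ ≤ r := le_max_right _ _
  have hr0 : 0 ≤ r := (norm_nonneg a).trans hra
  have hrb : ‖b‖ ≤ r ^ 2 := (Real.sqrt_le_left hr0).1 hrb'
  have hrpos : 0 < r := by
    refine lt_of_le_of_ne hr0 fun h => hv ?_
    rw [← h] at hra hrb
    have ha0 : a = 0 := norm_le_zero_iff.1 hra
    have hb0 : b = 0 := norm_le_zero_iff.1 (by simpa using hrb)
    rw [hab, ha0, hb0]; simp
  set a' : K := r⁻¹ • a with ha'
  set b' : S := (r ^ 2)⁻¹ • b with hb'
  have haa : a = r • a' := by rw [ha', smul_inv_smul₀ hrpos.ne']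
  have hbb : b = r ^ 2 • b' := by rw [hb', smul_inv_smul₀ (pow_pos hrpos 2).ne']
  have hna : ‖a'‖ = ‖a‖ / r := by
    rw [ha', norm_smul, norm_inv, Real.norm_eq_abs, abs_of_pos hrpos]; field_simp
  have hnb : ‖b'‖ = ‖b‖ / r ^ 2 := by
    rw [hb', norm_smul, norm_inv, Real.norm_eq_abs, abs_of_pos (pow_pos hrpos 2)]; field_simp
  have hna1 : ‖a'‖ ≤ 1 := by rw [hna]; exact (div_le_one hrpos).2 hra
  have hnb1 : ‖b'‖ ≤ 1 := by rw [hnb]; exact (div_le_one (pow_pos hrpos 2)).2 hrb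
  have hsph : (a', b') ∈ Metric.sphere (0 : K × S) 1 := by
    rw [mem_sphere_zero_iff_norm, Prod.norm_mk]
    refine le_antisymm (max_le hna1 hnb1) ?_
    rcases max_choice ‖a‖ √‖b‖ with h | h
    · have : r = ‖a‖ := h
      exact le_max_of_le_left (by rw [hna, ← this, div_self hrpos.ne'])
    · have : r = √‖b‖ := h
      refine le_max_of_le_right ?_
      rw [hnb, this, Real.sq_sqrt (norm_nonneg _), div_self]
      intro h0
      rw [this, h0] at hrpos
      simp at hrpos
  have hQv := hQ _ hsph
  have hv2 : v = r • (a' : W) + r ^ 2 • (b' : W) := by rw [hab, haa, hbb]; rfl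
  have hvr : v = r • ((a' : W) + r • (b' : W)) := by
    rw [hv2, smul_add, smul_smul, pow_two]
  have hnv : ‖v‖ ≤ 2 * r := by
    rw [hvr, norm_smul, Real.norm_eq_abs, abs_of_pos hrpos, mul_comm]
    refine mul_le_mul_of_nonneg_right ?_ hr0
    refine (norm_add_le _ _).trans ?_
    rw [norm_smul, Real.norm_eq_abs, abs_of_pos hrpos]
    have h2 : ‖(a' : W)‖ ≤ 1 := hna1
    have h3 : ‖(b' : W)‖ ≤ 1 := hnb1
    nlinarith [norm_nonneg (b' : W)]
  have hnv4 : ‖v‖ ^ 4 ≤ 16 * r ^ 4 := by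
    calc ‖v‖ ^ 4 ≤ (2 * r) ^ 4 := by gcongr
      _ = 16 * r ^ 4 := by ring
  have hBv : B ![v, v] = r ^ 4 * B ![(b' : W), (b' : W)] := by
    have h0 (w : W) : B ![(a : W), w] = 0 := a.2 w
    rw [hab, map_vec2_add_left, h0, zero_add, Bs, map_vec2_add_left, h0, zero_add, hbb,
      Submodule.coe_smul, map_vec2_smul_left, Bs, map_vec2_smul_left]
    ring
  have hCv : C ![v, v, v] = r ^ 4 * (3 * C ![(a' : W), (a' : W), (b' : W)]
      + r * (3 * C ![(a' : W), (b' : W), (b' : W)]) +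
        r ^ 2 * C ![(b' : W), (b' : W), (b' : W)]) := by
    have h0 : C ![(a' : W), (a' : W), (a' : W)] = 0 := by
      by_cases h : (a' : W) = 0
      · exact C.map_coord_zero 0 (by simp [h])
      · exact hf.cubic a' a'.2 h
    have add2 (x y y' z : W) : C ![x, y + y', z] = C ![x, y, z] + C ![x, y', z] := by
      rw [Cs1, map_vec3_add_left, Cs1 y, Cs1 y']
    have add3 (x y z z' : W) : C ![x, y, z + z'] = C ![x, y, z] + C ![x, y, z'] := by
      rw [Cs2, add2, Cs2 x z, Cs2 x z']
    have smul2 (c : ℝ) (x y z : W) : C ![x, c • y, z] = c * C ![x, y, z] := by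
      rw [Cs1, map_vec3_smul_left, Cs1]
    have smul3 (c : ℝ) (x y z : W) : C ![x, y, c • z] = c * C ![x, y, z] := by
      rw [Cs2, smul2, Cs2]
    simp only [hv2, map_vec3_add_left, add2, add3, map_vec3_smul_left, smul2, smul3, h0]
    rw [Cs1 b' a' b', Cs2 b' b' a', Cs1 b' a' b', Cs1 b' a' a', Cs2 a' b' a']
    ring
  have hDv : D ![v, v, v, v] = r ^ 4 * D ![(a' + r • b' : W), (a' + r • b' : W),
      (a' + r • b' : W), (a' + r • b' : W)] := by
    have h := D.map_smul_univ (fun _ => r) (fun _ => (a' + r • b' : W))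
    rw [Finset.prod_const, Finset.card_univ, Fintype.card_fin, smul_eq_mul] at h
    have e4 (w : W) : ![w, w, w, w] = fun _ => w := by funext i; fin_cases i <;> rfl
    rw [e4, e4, ← h, ← hvr]
  rw [hf.map_zero, hf.critical, ← hB, ← hC, ← hD, hBv, hCv, hDv] at hT
  simp only [Q] at hQv
  have hr4 : 0 < r ^ 4 := pow_pos hrpos 4
  have h5 := mul_lt_mul_of_pos_left hQv hr4
  have h6 : q / 32 * ‖v‖ ^ 4 ≤ q / 32 * (16 * r ^ 4) := by gcongr
  have h7 : 0 < q * r ^ 4 := mul_pos hq hr4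
  refine lt_of_lt_of_le ?_ hT
  simp only [_root_.zero_apply]
  linarith

end Minimum

/-! ### Vector fields in charts and their integral curves -/

section VectorField

variable {E : Type*} [NormedAddCommGroup E] [NormedSpace ℝ E]
  {M : Type*} [TopologicalSpace M] [ChartedSpace E M]

/-- The expression of a vector field in the preferred chart at `x₀`. -/
def chartVF (X : (y : M) → TangentSpace 𝓘(ℝ, E) y) (x₀ : M) (u : E) : E :=
  mfderiv 𝓘(ℝ, E) 𝓘(ℝ, E) (chartAt E x₀) ((chartAt E x₀).symm u) (X ((chartAt E x₀).symm u))

theorem contMDiffAt_chartAt_symm {n : ℕ∞ω} [IsManifold 𝓘(ℝ, E) n M] (x₀ : M) {u : E}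
    (hu : u ∈ (chartAt E x₀).target) :
    ContMDiffAt 𝓘(ℝ, E) 𝓘(ℝ, E) n (chartAt E x₀).symm u :=
  (contMDiffOn_chart_symm (I := 𝓘(ℝ, E)) (n := n) (x := x₀)).contMDiffAt
    ((chartAt E x₀).open_target.mem_nhds hu)

theorem contMDiffAt_chartAt {n : ℕ∞ω} [IsManifold 𝓘(ℝ, E) n M] (x₀ : M) {y : M}
    (hy : y ∈ (chartAt E x₀).source) :
    ContMDiffAt 𝓘(ℝ, E) 𝓘(ℝ, E) n (chartAt E x₀) y :=
  (contMDiffOn_chart (I := 𝓘(ℝ, E)) (n := n) (x := x₀)).contMDiffAt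
    ((chartAt E x₀).open_source.mem_nhds hy)

variable [IsManifold 𝓘(ℝ, E) 1 M]

theorem mdifferentiableAt_chartAt_symm (x₀ : M) {u : E} (hu : u ∈ (chartAt E x₀).target) :
    MDifferentiableAt 𝓘(ℝ, E) 𝓘(ℝ, E) (chartAt E x₀).symm u :=
  mdifferentiableAt_atlas_symm (chart_mem_atlas E x₀) hu

theorem mdifferentiableAt_chartAt (x₀ : M) {y : M} (hy : y ∈ (chartAt E x₀).source) :
    MDifferentiableAt 𝓘(ℝ, E) 𝓘(ℝ, E) (chartAt E x₀) y :=
  mdifferentiableAt_atlas (chart_mem_atlas E x₀) hy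

theorem mfderiv_chartAt_symm_comp (x₀ : M) {y : M} (hy : y ∈ (chartAt E x₀).source)
    (v : TangentSpace 𝓘(ℝ, E) y) :
    mfderiv 𝓘(ℝ, E) 𝓘(ℝ, E) (chartAt E x₀).symm (chartAt E x₀ y)
      (mfderiv 𝓘(ℝ, E) 𝓘(ℝ, E) (chartAt E x₀) y v) = v := 
  DFunLike.congr_fun ((mdifferentiable_chart (I := 𝓘(ℝ, E)) x₀).symm_comp_deriv hy) v

theorem mfderiv_chartAt_comp_symm (x₀ : M) {u : E} (hu : u ∈ (chartAt E x₀).target)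
    (v : E) :
    mfderiv 𝓘(ℝ, E) 𝓘(ℝ, E) (chartAt E x₀) ((chartAt E x₀).symm u)
      (mfderiv 𝓘(ℝ, E) 𝓘(ℝ, E) (chartAt E x₀).symm u v) = v := 
  DFunLike.congr_fun ((mdifferentiable_chart (I := 𝓘(ℝ, E)) x₀).comp_symm_deriv hu) v

theorem mfderiv_chartAt_symm_chartVF (X : (y : M) → TangentSpace 𝓘(ℝ, E) y) (x₀ : M) {u : E}
    (hu : u ∈ (chartAt E x₀).target) :
    mfderiv 𝓘(ℝ, E) 𝓘(ℝ, E) (chartAt E x₀).symm u (chartVF (E := E) X x₀ u) =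
      X ((chartAt E x₀).symm u) := by
  have h := mfderiv_chartAt_symm_comp x₀ ((chartAt E x₀).map_target hu) (X ((chartAt E x₀).symm u))
  rw [(chartAt E x₀).right_inv hu] at h
  exact h

/-- The tangent bundle trivialization at `x₀` is, over the chart domain, the derivative of the
chart, so both sides concern the same coordinate expression. -/
theorem contMDiffAt_vectorField_iff {X : (y : M) → TangentSpace 𝓘(ℝ, E) y} {x₀ : M} :
    ContMDiffAt 𝓘(ℝ, E) 𝓘(ℝ, E).tangent 1 (fun y => (⟨y, X y⟩ : TangentBundle 𝓘(ℝ, E) M)) x₀ ↔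
      ContDiffAt ℝ 1 (chartVF X x₀) (chartAt E x₀ x₀) := by
  have h1 := Bundle.contMDiffAt_section (IB := 𝓘(ℝ, E)) (F := E) (E := TangentSpace 𝓘(ℝ, E))
    (n := 1) (s := X) x₀
  refine h1.trans ?_
  rw [contMDiffAt_iff_source, modelWithCornersSelf_coe, range_id, contMDiffWithinAt_univ,
    contMDiffAt_iff_contDiffAt]
  have hev : ∀ᶠ u in 𝓝 (chartAt E x₀ x₀), chartVF X x₀ u =
      (trivializationAt E (TangentSpace 𝓘(ℝ, E)) x₀
        ⟨(chartAt E x₀).symm u, X ((chartAt E x₀).symm u)⟩).2 := by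
    filter_upwards [chart_target_mem_nhds E x₀] with u hu
    exact DFunLike.congr_fun (mfderiv_chartAt_eq_tangentCoordChange (I := 𝓘(ℝ, E))
      ((chartAt E x₀).map_target hu)) (X ((chartAt E x₀).symm u))
  exact ⟨fun h => h.congr_of_eventuallyEq hev,
    fun h => h.congr_of_eventuallyEq (hev.mono fun _ h => h.symm)⟩

theorem hasMFDerivAt_chartAt_symm_comp {X : (y : M) → TangentSpace 𝓘(ℝ, E) y} {x₀ : M}
    {α : ℝ → E} {t : ℝ}
    (ht : α t ∈ (chartAt E x₀).target) (hα : HasDerivAt α (chartVF X x₀ (α t)) t) :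
    HasMFDerivAt 𝓘(ℝ, ℝ) 𝓘(ℝ, E) (fun s => (chartAt E x₀).symm (α s)) t
      ((1 : ℝ →L[ℝ] ℝ).smulRight (X ((chartAt E x₀).symm (α t)))) := by
  have h1 := (mdifferentiableAt_chartAt_symm x₀ ht).hasMFDerivAt
  have h2 : HasMFDerivAt 𝓘(ℝ, ℝ) 𝓘(ℝ, E) α t
    ((1 : ℝ →L[ℝ] ℝ).smulRight (chartVF (E := E) X x₀ (α t))) :=
    hα.hasFDerivAt.hasMFDerivAt
  have h3 := HasMFDerivAt.comp t h1 h2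
  refine h3.congr_mfderiv ?_
  refine ContinuousLinearMap.ext fun c => ?_
  have h4 := mfderiv_chartAt_symm_chartVF X x₀ ht
  have h5 := (mfderiv 𝓘(ℝ, E) 𝓘(ℝ, E) (chartAt E x₀).symm (α t)).map_smul c
    (chartVF (E := E) X x₀ (α t))
  rw [h4] at h5
  exact h5

/-- Integral curves that start near `x₀` exist for a uniform time and remain near `x₀`. -/
theorem exists_local_integralCurves [CompleteSpace E] {X : (y : M) → TangentSpace 𝓘(ℝ, E) y}
    {x₀ : M} (hX : ContMDiffAt 𝓘(ℝ, E) 𝓘(ℝ, E).tangent 1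
      (fun y => (⟨y, X y⟩ : TangentBundle 𝓘(ℝ, E) M)) x₀) {O : Set M} (hO : O ∈ 𝓝 x₀) :
    ∃ ε > 0, ∀ᶠ y in 𝓝 x₀, ∃ γ : ℝ → M, γ 0 = y ∧ IsMIntegralCurveOn γ X (Ioo (-ε) ε) ∧
      ∀ t ∈ Ioo (-ε) ε, γ t ∈ O := by
  have hY := contMDiffAt_vectorField_iff.1 hX
  set e := chartAt E x₀ with he
  obtain ⟨ε, hε, a, r, L, K, hr, hpl⟩ := IsPicardLindelof.of_contDiffAt_one hY
  obtain ⟨α, hα, hαc⟩ := (hpl 0).exists_forall_mem_closedBall_eq_hasDerivWithinAt_continuousOn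
  have hnhds : Metric.closedBall (e x₀) r ×ˢ Icc (0 - ε) (0 + ε) ∈ 𝓝 (e x₀, (0 : ℝ)) :=
    prod_mem_nhds (Metric.closedBall_mem_nhds _ (by exact_mod_cast hr))
      (Icc_mem_nhds (by linarith) (by linarith))
  have hα0 : α (e x₀, 0) = e x₀ := (hα _ (Metric.mem_closedBall_self r.2)).1
  have hO' : e.target ∩ e.symm ⁻¹' O ∈ 𝓝 (e x₀) := by
    refine inter_mem (chart_target_mem_nhds E x₀) ?_
    have hc : ContinuousAt e.symm (e x₀) := e.continuousAt_symm (mem_chart_target E x₀)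
    refine hc.preimage_mem_nhds ?_
    rwa [e.left_inv (mem_chart_source E x₀)]
  have hev : ∀ᶠ p in 𝓝 (e x₀, (0 : ℝ)), α p ∈ e.target ∩ e.symm ⁻¹' O :=
    (hαc.continuousAt hnhds).preimage_mem_nhds (by rwa [hα0])
  -- The local flow is jointly continuous in initial point and time, so a product neighbourhood
  -- gives one time interval for all nearby initial points.
  obtain ⟨A, hA, T, hT, hAT⟩ := mem_nhds_prod_iff.1 (inter_mem hev hnhds)
  obtain ⟨δ, hδ, hδT⟩ := Metric.mem_nhds_iff.1 hT
  refine ⟨min δ ε, lt_min hδ hε, ?_⟩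
  have hsrc : ∀ᶠ y in 𝓝 x₀, y ∈ e.source := chart_source_mem_nhds E x₀
  have hAe : ∀ᶠ y in 𝓝 x₀, e y ∈ A := (e.continuousAt (mem_chart_source E x₀)).eventually hA
  filter_upwards [hsrc, hAe] with y hy hyA
  have hmem : ∀ t ∈ Ioo (-min δ ε) (min δ ε), (e y, t) ∈ A ×ˢ T := by
    intro t ht
    refine ⟨hyA, hδT ?_⟩
    rw [mem_ball_zero_iff, Real.norm_eq_abs, abs_lt]
    exact ⟨by linarith [ht.1, min_le_left δ ε], by linarith [ht.2, min_le_left δ ε]⟩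
  have h0 : (0 : ℝ) ∈ Ioo (-min δ ε) (min δ ε) := by
    have := lt_min hδ hε
    constructor <;> linarith
  have hyr := (hAT (hmem 0 h0)).2.1
  obtain ⟨hα1, hα2⟩ := hα (e y) hyr
  refine ⟨fun t => e.symm (α (e y, t)), ?_, fun t ht => ?_, fun t ht => ?_⟩
  · exact (congrArg e.symm hα1).trans (e.left_inv hy)
  · have hder : HasDerivAt (fun s => α (e y, s)) (chartVF X x₀ (α (e y, t))) t := by
      have htε : t ∈ Ioo (0 - ε) (0 + ε) :=
        ⟨by linarith [ht.1, min_le_right δ ε], by linarith [ht.2, min_le_right δ ε]⟩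
      exact (hα2 t (Ioo_subset_Icc_self htε)).hasDerivAt (Icc_mem_nhds htε.1 htε.2)
    exact (hasMFDerivAt_chartAt_symm_comp (hAT (hmem t ht)).1.1 hder).hasMFDerivWithinAt
  · exact (hAT (hmem t ht)).1.2

/-- A curve of uniform lifetime is restarted at `γ t₀` and glued to `γ`; uniqueness of integral
curves makes the pieces agree on the overlap. -/
theorem exists_integralCurveOn_union [T2Space M] {X : (y : M) → TangentSpace 𝓘(ℝ, E) y}
    (hX : ContMDiff 𝓘(ℝ, E) 𝓘(ℝ, E).tangent 1 (fun y => (⟨y, X y⟩ : TangentBundle 𝓘(ℝ, E) M)))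
    {S : Set M} {ε : ℝ} (hε : 0 < ε)
    (h : ∀ y ∈ S, ∃ γ : ℝ → M, γ 0 = y ∧ IsMIntegralCurveOn γ X (Ioo (-ε) ε) ∧
      ∀ t ∈ Ioo (-ε) ε, γ t ∈ S) {a b t₀ : ℝ} (ht₀ : t₀ ∈ Ioo a b) {γ : ℝ → M}
    (hγ : IsMIntegralCurveOn γ X (Ioo a b)) (hS : ∀ t ∈ Ioo a b, γ t ∈ S) :
    ∃ γ' : ℝ → M, EqOn γ' γ (Ioo a b) ∧
      IsMIntegralCurveOn γ' X (Ioo a b ∪ Ioo (t₀ - ε) (t₀ + ε)) ∧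
      ∀ t ∈ Ioo a b ∪ Ioo (t₀ - ε) (t₀ + ε), γ' t ∈ S := by
  obtain ⟨β, hβ0, hβ, hβS⟩ := h (γ t₀) (hS t₀ ht₀)
  have hβ' : IsMIntegralCurveOn (β ∘ (· - t₀)) X (Ioo (t₀ - ε) (t₀ + ε)) := by
    have h1 := (isMIntegralCurveOn_comp_sub (dt := t₀)).2 hβ
    refine h1.mono fun t ht => ?_
    exact ⟨by linarith [ht.1], by linarith [ht.2]⟩
  classical
  refine ⟨piecewise (Ioo a b) γ (β ∘ (· - t₀)), piecewise_eqOn _ _ _,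
    isMIntegralCurveOn_piecewise hX hγ hβ' (t₀ := t₀)
      ⟨ht₀, by linarith, by linarith⟩ (by simp [hβ0]), fun t ht => ?_⟩
  by_cases hab : t ∈ Ioo a b
  · rw [piecewise_eq_of_mem _ _ _ hab]
    exact hS t hab
  · rw [piecewise_eq_of_notMem _ _ _ hab]
    have ht' := ht.resolve_left hab
    exact hβS _ ⟨by linarith [ht'.1], by linarith [ht'.2]⟩

/-- If through every point of `S` there is an integral curve in `S` defined for a uniform time, then
through every point of `S` there is an integral curve in `S` defined for all time. -/
theorem exists_global_integralCurve [T2Space M] {X : (y : M) → TangentSpace 𝓘(ℝ, E) y}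
    (hX : ContMDiff 𝓘(ℝ, E) 𝓘(ℝ, E).tangent 1 (fun y => (⟨y, X y⟩ : TangentBundle 𝓘(ℝ, E) M)))
    {S : Set M} {ε : ℝ} (hε : 0 < ε)
    (h : ∀ y ∈ S, ∃ γ : ℝ → M, γ 0 = y ∧ IsMIntegralCurveOn γ X (Ioo (-ε) ε) ∧
      ∀ t ∈ Ioo (-ε) ε, γ t ∈ S) {y : M} (hy : y ∈ S) :
    ∃ γ : ℝ → M, γ 0 = y ∧ IsMIntegralCurve γ X ∧ ∀ t, γ t ∈ S := by
  have step : ∀ n : ℕ, ∃ γ : ℝ → M, γ 0 = y ∧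
      IsMIntegralCurveOn γ X (Ioo (-(ε + n * (ε / 2))) (ε + n * (ε / 2))) ∧
      ∀ t ∈ Ioo (-(ε + n * (ε / 2))) (ε + n * (ε / 2)), γ t ∈ S := by
    intro n
    induction n with
    | zero => simpa using h y hy
    | succ n ih =>
      obtain ⟨γ, hγ0, hγ, hγS⟩ := ih
      set a := ε + n * (ε / 2) with ha
      have hεa : ε ≤ a := by rw [ha]; have : 0 ≤ n * (ε / 2) := by positivity
                             linarith
      -- Restarting ε/2 before the endpoint keeps the base point inside the interval and still gains
      -- ε/2. The left end is treated the same way.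
      obtain ⟨γ₁, h₁e, h₁, h₁S⟩ := exists_integralCurveOn_union hX hε h
        (t₀ := a - ε / 2) ⟨by linarith, by linarith⟩ hγ hγS
      have hu₁ : Ioo (-a) (a + ε / 2) ⊆ Ioo (-a) a ∪ Ioo (a - ε / 2 - ε) (a - ε / 2 + ε) := by
        intro t ht
        by_cases hta : t < a
        · exact Or.inl ⟨ht.1, hta⟩
        · exact Or.inr ⟨by linarith [not_lt.1 hta], by linarith [ht.2]⟩
      obtain ⟨γ₂, h₂e, h₂, h₂S⟩ := exists_integralCurveOn_union hX hε h
        (t₀ := -a + ε / 2) ⟨by linarith, by linarith⟩ (h₁.mono hu₁)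
        (fun t ht => h₁S t (hu₁ ht))
      have hcast : ε + ((n + 1 : ℕ) : ℝ) * (ε / 2) = a + ε / 2 := by
        rw [ha]; push_cast; ring
      have hu₂ : Ioo (-(a + ε / 2)) (a + ε / 2) ⊆
          Ioo (-a) (a + ε / 2) ∪ Ioo (-a + ε / 2 - ε) (-a + ε / 2 + ε) := by
        intro t ht
        by_cases hta : -a < t
        · exact Or.inl ⟨hta, ht.2⟩
        · exact Or.inr ⟨by linarith [ht.1], by linarith [not_lt.1 hta]⟩
      rw [hcast]
      refine ⟨γ₂, ?_, h₂.mono hu₂, fun t ht => h₂S t (hu₂ ht)⟩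
      rw [h₂e ⟨by linarith, by linarith⟩, h₁e ⟨by linarith, by linarith⟩, hγ0]
  have hlarge (a : ℝ) : ∃ n : ℕ, a < ε + n * (ε / 2) := by
    obtain ⟨n, hn⟩ := exists_nat_gt (a / (ε / 2))
    exact ⟨n, by have := (div_lt_iff₀ (half_pos hε)).1 hn; linarith⟩
  obtain ⟨γ, hγ0, hγ⟩ := (exists_isMIntegralCurve_iff_exists_isMIntegralCurveOn_Ioo hX y).2 fun a =>
    let ⟨n, hn⟩ := hlarge a
    let ⟨γ, h0, h1, _⟩ := step n
    ⟨γ, h0, h1.mono (Ioo_subset_Ioo (by linarith) hn.le)⟩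
  refine ⟨γ, hγ0, hγ, fun t => ?_⟩
  obtain ⟨n, hn⟩ := hlarge |t|
  obtain ⟨β, hβ0, hβ, hβS⟩ := step n
  have ht := abs_lt.1 hn
  have h0 := abs_lt.1 ((abs_zero (α := ℝ)).trans_lt ((abs_nonneg t).trans_lt hn))
  rw [isMIntegralCurveOn_Ioo_eqOn_of_contMDiff_boundaryless h0 hX (hγ.isMIntegralCurveOn _) hβ
    (hγ0.trans hβ0.symm) ht]
  exact hβS t ht

/-- A local integral curve through `x₀` that is continuously differentiable. -/
theorem exists_contMDiffAt_integralCurve [CompleteSpace E]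
    {X : (y : M) → TangentSpace 𝓘(ℝ, E) y}
    {x₀ : M} (hX : ContMDiffAt 𝓘(ℝ, E) 𝓘(ℝ, E).tangent 1
      (fun y => (⟨y, X y⟩ : TangentBundle 𝓘(ℝ, E) M)) x₀) :
    ∃ γ : ℝ → M, γ 0 = x₀ ∧ IsMIntegralCurveAt γ X 0 ∧ ContMDiffAt 𝓘(ℝ, ℝ) 𝓘(ℝ, E) 1 γ 0 := by
  have hY := contMDiffAt_vectorField_iff.1 hX
  obtain ⟨α, hα0, ε, hε, hα⟩ :=
    hY.exists_forall_mem_closedBall_exists_eq_forall_mem_Ioo_hasDerivAt₀ 0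
  have hev : ∀ᶠ t in 𝓝 (0 : ℝ), HasDerivAt α (chartVF X x₀ (α t)) t :=
    mem_of_superset (Ioo_mem_nhds (by linarith) (by linarith)) hα
  have hαc : ContinuousAt α 0 := hev.self_of_nhds.continuousAt
  have htar : ∀ᶠ t in 𝓝 (0 : ℝ), α t ∈ (chartAt E x₀).target :=
    hαc.eventually (by rw [hα0]; exact chart_target_mem_nhds E x₀)
  refine ⟨fun t => (chartAt E x₀).symm (α t), ?_, ?_, ?_⟩
  · exact (congrArg (chartAt E x₀).symm hα0).trans
      ((chartAt E x₀).left_inv (mem_chart_source E x₀))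
  · filter_upwards [hev, htar] with t h1 h2
    exact hasMFDerivAt_chartAt_symm_comp h2 h1
  · have hα1 : ContDiffAt ℝ 1 α 0 := by
      have hYc : ∀ᶠ t in 𝓝 (0 : ℝ), ContinuousAt (chartVF X x₀) (α t) :=
        hαc.eventually (by
          rw [hα0]
          exact (hY.eventually (by norm_num)).mono fun _ h => h.continuousAt)
      refine contDiffAt_one_iff.2 ⟨fun t => (1 : ℝ →L[ℝ] ℝ).smulRight (chartVF X x₀ (α t)), _,
        hev.and hYc, fun t ht => ContinuousAt.continuousWithinAt ?_,
        fun t ht => ht.1.hasFDerivAt⟩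
      have h1 : ContinuousAt (fun s => chartVF X x₀ (α s)) t :=
        ContinuousAt.comp (f := α) ht.2 ht.1.continuousAt
      exact ((ContinuousLinearMap.smulRightL ℝ ℝ E 1).continuous.continuousAt).comp h1
    have h1 : ContMDiffAt 𝓘(ℝ, E) 𝓘(ℝ, E) 1 (chartAt E x₀).symm (α 0) :=
      contMDiffAt_chartAt_symm x₀ htar.self_of_nhds
    exact ContMDiffAt.comp 0 h1 hα1.contMDiffAt

end VectorField

/-! ### Regularity of Hamiltonian vector fields -/

section HamiltonianVectorField

variable {E : Type*} [NormedAddCommGroup E] [NormedSpace ℝ E]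

/-- A continuous alternating 2-form as a continuous linear map to the dual. -/
def flatMap (η : E [⋀^Fin 2]→L[ℝ] ℝ) : E →L[ℝ] E →L[ℝ] ℝ :=
  ((continuousMultilinearCurryFin1 ℝ E ℝ).toContinuousLinearEquiv :
    (E [×1]→L[ℝ] ℝ) →L[ℝ] (E →L[ℝ] ℝ)) ∘L
  (continuousMultilinearCurryLeftEquiv ℝ (fun _ : Fin 2 => E) ℝ
    (ContinuousAlternatingMap.toContinuousMultilinearMapLI (𝕜 := ℝ) (E := E) (F := ℝ)
      (ι := Fin 2) η))

theorem contDiff_flatMap {n : ℕ∞ω} : ContDiff ℝ n (flatMap (E := E)) :=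
  contDiff_const.clm_comp ((LinearIsometryEquiv.contDiff _).comp (LinearIsometry.contDiff _))

theorem flatMap_apply (η : E [⋀^Fin 2]→L[ℝ] ℝ) (v w : E) : flatMap η v w = η ![v, w] := by
  change η (Fin.cons v (Fin.snoc 0 w)) = _
  congr 1
  funext i; fin_cases i <;> rfl

variable {M : Type*} [TopologicalSpace M] [ChartedSpace E M]

theorem chartForm_apply (Ω : (x : M) → (TangentSpace 𝓘(ℝ, E) x) [⋀^Fin 2]→L[ℝ] ℝ) (x₀ : M)
    (u v w : E) :
    chartForm Ω x₀ u ![v, w] = Ω ((chartAt E x₀).symm u)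
      ![mfderiv 𝓘(ℝ, E) 𝓘(ℝ, E) (chartAt E x₀).symm u v,
        mfderiv 𝓘(ℝ, E) 𝓘(ℝ, E) (chartAt E x₀).symm u w] := by
  change Ω ((chartAt E x₀).symm u)
    (fun i => mfderiv 𝓘(ℝ, E) 𝓘(ℝ, E) (chartAt E x₀).symm u (![v, w] i)) = _
  congr 1
  funext i; fin_cases i <;> rfl

variable [IsManifold 𝓘(ℝ, E) 1 M] [FiniteDimensional ℝ E]

theorem SymplecticForm.isInvertible_flatMap (Ω : SymplecticForm E M) (x₀ : M) {u : E}
    (hu : u ∈ (chartAt E x₀).target) :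
    ∃ A : E ≃L[ℝ] (E →L[ℝ] ℝ), (A : E →L[ℝ] E →L[ℝ] ℝ) = flatMap (chartForm Ω.form x₀ u) := by
  have hinj : Function.Injective (flatMap (chartForm Ω.form x₀ u)).toLinearMap := by
    rw [← LinearMap.ker_eq_bot, LinearMap.ker_eq_bot']
    intro v hv
    have h1 (w : E) : chartForm Ω.form x₀ u ![v, w] = 0 := by
      rw [← flatMap_apply]
      exact DFunLike.congr_fun hv w
    have h2 := Ω.nondegenerate _ (mfderiv 𝓘(ℝ, E) 𝓘(ℝ, E) (chartAt E x₀).symm u v) fun w => by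
      obtain ⟨w', hw'⟩ : ∃ w' : E, mfderiv 𝓘(ℝ, E) 𝓘(ℝ, E) (chartAt E x₀).symm u w' = w := by
        have h4 := mfderiv_chartAt_symm_comp x₀ ((chartAt E x₀).map_target hu) w
        rw [(chartAt E x₀).right_inv hu] at h4
        exact ⟨_, h4⟩
      have h3 := h1 w'
      rwa [chartForm_apply, hw'] at h3
    have h5 := mfderiv_chartAt_comp_symm x₀ hu v
    rw [h2, map_zero] at h5
    exact h5.symm
  have hdim : Module.finrank ℝ E = Module.finrank ℝ (E →L[ℝ] ℝ) := by
    rw [← (LinearMap.toContinuousLinearMap (𝕜 := ℝ) (E := E) (F' := ℝ)).finrank_eq]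
    exact Subspace.dual_finrank_eq.symm
  refine ⟨(LinearEquiv.ofInjectiveOfFinrankEq _ hinj hdim).toContinuousLinearEquiv, ?_⟩
  ext v w
  rfl

theorem SymplecticForm.chartForm_chartVF_hamVF (Ω : SymplecticForm E M) {H : M → ℝ} 
    (hH : MDifferentiable 𝓘(ℝ, E) 𝓘(ℝ, ℝ) H) (x₀ : M) {u : E} (hu : u ∈ (chartAt E x₀).target) :
    flatMap (chartForm Ω.form x₀ u) (chartVF (Ω.hamVF H) x₀ u) =
      fderiv ℝ (fun w => H ((chartAt E x₀).symm w)) u := by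
  ext w
  rw [flatMap_apply, chartForm_apply, mfderiv_chartAt_symm_chartVF _ _ hu, Ω.form_hamVF]
  have h1 := mfderiv_comp_apply u (hH ((chartAt E x₀).symm u))
    (mdifferentiableAt_chartAt_symm x₀ hu) w
  rw [mfderiv_eq_fderiv] at h1
  exact h1.symm

/-- In a chart `X_H` is the inverse of the flat map of Ω applied to the derivative of H. Inversion
of continuous linear maps is smooth at invertible ones, and nondegeneracy with a dimension count
gives invertibility. -/
theorem SymplecticForm.contMDiff_hamVF [IsManifold 𝓘(ℝ, E) ∞ M] (Ω : SymplecticForm E M)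
    {H : M → ℝ} (hH : ContMDiff 𝓘(ℝ, E) 𝓘(ℝ, ℝ) ∞ H) :
    ContMDiff 𝓘(ℝ, E) 𝓘(ℝ, E).tangent 1
      (fun y => (⟨y, Ω.hamVF H y⟩ : TangentBundle 𝓘(ℝ, E) M)) := by
  intro x₀
  rw [contMDiffAt_vectorField_iff]
  set e := chartAt E x₀ with he
  have hx : e x₀ ∈ e.target := mem_chart_target E x₀
  obtain ⟨A, hA⟩ := Ω.isInvertible_flatMap x₀ hx
  have hform : ContDiffAt ℝ 1 (fun u => flatMap (chartForm Ω.form x₀ u)) (e x₀) :=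
    ContDiffAt.comp (g := flatMap (E := E)) (e x₀) contDiff_flatMap.contDiffAt
      (((Ω.smooth x₀).contDiffAt (e.open_target.mem_nhds hx)).of_le (by norm_cast))
  have hinv : ContDiffAt ℝ 1 (fun u => (flatMap (chartForm Ω.form x₀ u)).inverse) (e x₀) :=
    ContDiffAt.comp (g := ContinuousLinearMap.inverse) (e x₀)
      (by rw [← hA]; exact contDiffAt_map_inverse A) hform
  have hd : ContDiffAt ℝ 1 (fun u => fderiv ℝ (fun w => H (e.symm w)) u) (e x₀) := by
    have h1 : ContMDiffAt 𝓘(ℝ, E) 𝓘(ℝ, ℝ) ∞ (fun w => H (e.symm w)) (e x₀) :=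
      ContMDiffAt.comp (e x₀) hH.contMDiffAt (contMDiffAt_chartAt_symm x₀ hx)
    exact h1.contDiffAt.fderiv_right (m := 1) (by norm_cast)
  refine (hinv.clm_apply hd).congr_of_eventuallyEq ?_
  filter_upwards [chart_target_mem_nhds E x₀] with u hu
  obtain ⟨B, hB⟩ := Ω.isInvertible_flatMap x₀ hu
  rw [← Ω.chartForm_chartVF_hamVF (hH.mdifferentiable (by simp)) x₀ hu, ← hB,
    ContinuousLinearMap.inverse_equiv]
  exact (B.symm_apply_apply _).symm

end HamiltonianVectorField

/-! ### Functions constant along integral curves -/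

section Invariance

variable {E : Type*} [NormedAddCommGroup E] [NormedSpace ℝ E]
  {M : Type*} [TopologicalSpace M] [ChartedSpace E M]

theorem differential_self_hamVF [FiniteDimensional ℝ E] (Ω : SymplecticForm E M) (H : M → ℝ)
    (y : M) : differential H y (Ω.hamVF H y) = 0 := by
  rw [← Ω.form_hamVF]
  exact (Ω.form y).map_eq_zero_of_eq _ (i := 0) (j := 1) rfl (by decide)

theorem form_swap (Ω : SymplecticForm E M) (y : M) (v w : TangentSpace 𝓘(ℝ, E) y) :
    Ω.form y ![v, w] = - Ω.form y ![w, v] := by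
  have h := (Ω.form y).map_swap ![v, w] (i := 0) (j := 1) (by decide)
  have h2 : ![v, w] ∘ Equiv.swap 0 1 = ![w, v] := by funext i; fin_cases i <;> rfl
  rw [h2] at h
  exact (neg_eq_iff_eq_neg.2 h).symm

/-- A function whose differential vanishes along `X` is constant along the integral curves. -/
theorem eqOn_integralCurve_of_differential_eq_zero {X : (y : M) → TangentSpace 𝓘(ℝ, E) y}
    {f : M → ℝ} (hf : MDifferentiable 𝓘(ℝ, E) 𝓘(ℝ, ℝ) f)
    (h : ∀ y, differential f y (X y) = 0) {a b : ℝ} (h0 : (0 : ℝ) ∈ Ioo a b) {γ : ℝ → M}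
    (hγ : IsMIntegralCurveOn γ X (Ioo a b)) {t : ℝ} (ht : t ∈ Ioo a b) : f (γ t) = f (γ 0) := by
  have hd : ∀ s ∈ Ioo a b, HasDerivAt (fun s => f (γ s)) 0 s := by
    intro s hs
    have h1 := (hγ s hs).hasMFDerivAt (Ioo_mem_nhds hs.1 hs.2)
    have h2 := HasMFDerivAt.comp s (hf (γ s)).hasMFDerivAt h1
    have h3 : HasFDerivAt (fun s => f (γ s)) (0 : ℝ →L[ℝ] ℝ) s := by
      refine h2.hasFDerivAt.congr_fderiv (ContinuousLinearMap.ext fun (c : ℝ) => ?_)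
      have h6 := (differential f (γ s)).map_smul c (X (γ s))
      rw [h (γ s)] at h6
      exact h6.trans (smul_zero c)
    exact h3.hasDerivAt
  exact isOpen_Ioo.is_const_of_deriv_eq_zero isPreconnected_Ioo
    (fun s hs => (hd s hs).differentiableAt.differentiableWithinAt) (fun s hs => (hd s hs).deriv)
    ht h0

end Invariance

/-! ### Smooth group actions and invariant functions -/

section Action

variable {E : Type*} [NormedAddCommGroup E] [NormedSpace ℝ E]
  {M : Type*} [TopologicalSpace M] [ChartedSpace E M]
  {F : Type*} [NormedAddCommGroup F] [NormedSpace ℝ F]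
  {G : Type*} [TopologicalSpace G] [ChartedSpace F G] [Group G]
  [MulAction G M] [ContMDiffSMul 𝓘(ℝ, F) 𝓘(ℝ, E) ∞ G M]

theorem contMDiff_smul_pair :
    ContMDiff (𝓘(ℝ, F).prod 𝓘(ℝ, E)) 𝓘(ℝ, E) ∞ (fun p : G × M => p.1 • p.2) :=
  ContMDiffSMul.contMDiff_smul

theorem contMDiff_smul_left (y : M) :
    ContMDiff 𝓘(ℝ, F) 𝓘(ℝ, E) ∞ (fun g : G => g • y) := by
  exact contMDiff_smul_pair.comp (contMDiff_id.prodMk contMDiff_const)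

theorem differential_infAction_of_invariant {H : M → ℝ}
    (hH : MDifferentiable 𝓘(ℝ, E) 𝓘(ℝ, ℝ) H) (hHG : ∀ (g : G) (y : M), H (g • y) = H y) (y : M)
    (η : LieAlg F G) : differential (E := E) H y (infAction y η) = 0 := by
  have h1 : MDifferentiableAt 𝓘(ℝ, F) 𝓘(ℝ, E) (fun g : G => g • y) 1 :=
    (contMDiff_smul_left y).mdifferentiableAt (by simp)
  have h2 := mfderiv_comp_apply (I := 𝓘(ℝ, F)) (I' := 𝓘(ℝ, E)) (I'' := 𝓘(ℝ, ℝ)) (1 : G)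
    (hH ((1 : G) • y)) h1 η
  have h3 : (H ∘ fun g : G => g • y) = fun _ => H y := funext fun g => hHG g y
  rw [h3, mfderiv_const] at h2
  have h4 := mfderiv_congr_point (I := 𝓘(ℝ, E)) (I' := 𝓘(ℝ, ℝ)) (f := H) (one_smul G y)
  have h5 := DFunLike.congr_fun h4 (infAction y η : E)
  exact h5.symm.trans h2.symm

theorem mdifferentiable_const_smul_action (F : Type*) [NormedAddCommGroup F] [NormedSpace ℝ F]
    {G : Type*} [TopologicalSpace G] [ChartedSpace F G] [Group G]
    [MulAction G M] [ContMDiffSMul 𝓘(ℝ, F) 𝓘(ℝ, E) ∞ G M] (g : G) :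
    MDifferentiable 𝓘(ℝ, E) 𝓘(ℝ, E) (fun z : M => g • z) :=
  (ContMDiffSMul.contMDiff_const_smul (I := 𝓘(ℝ, F)) (n := ∞) g).mdifferentiable (by simp)

end Action

/-! ### Equivariance of the Hamiltonian flow -/

section Equivariance

variable {E : Type*} [NormedAddCommGroup E] [NormedSpace ℝ E]
  {M : Type*} [TopologicalSpace M] [ChartedSpace E M]
  {G : Type*} [Group G] [MulAction G M]

theorem tangentMap_surjective
    (hG : ∀ g : G, MDifferentiable 𝓘(ℝ, E) 𝓘(ℝ, E) (fun z : M => g • z)) (g : G) (y : M)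
        (w : TangentSpace 𝓘(ℝ, E) (g • y)) :
    ∃ v : TangentSpace 𝓘(ℝ, E) y, tangentMap g y v = w := by
  have h1 : ((fun z : M => g • z) ∘ fun z : M => g⁻¹ • z) = id := funext fun z => smul_inv_smul g z
  have h2 := mfderiv_comp_apply (g • y)
    (hG g (g⁻¹ • g • y))
    (hG g⁻¹ (g • y)) w
  rw [h1, mfderiv_id] at h2
  have h4 := mfderiv_congr_point (I := 𝓘(ℝ, E)) (I' := 𝓘(ℝ, E)) (f := fun z : M => g • z)
    (inv_smul_smul g y)
  refine ⟨(mfderiv 𝓘(ℝ, E) 𝓘(ℝ, E) (fun z : M => g⁻¹ • z) (g • y) w : E), ?_⟩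
  have h5 := DFunLike.congr_fun h4 (mfderiv 𝓘(ℝ, E) 𝓘(ℝ, E) (fun z : M => g⁻¹ • z) (g • y) w : E)
  exact h5.symm.trans h2.symm

variable [TopologicalSpace G]

/-- Both vectors have the same pairing under Ω with every tangent vector at `g • y`, since each such
vector is an image under `tangentMap g y` and both Ω and H are invariant. -/
theorem tangentMap_hamVF
    (hG : ∀ g : G, MDifferentiable 𝓘(ℝ, E) 𝓘(ℝ, E) (fun z : M => g • z))
    [FiniteDimensional ℝ E] {Ω : SymplecticForm E M}
    (hΩ : IsSymplecticAction G Ω) {H : M → ℝ}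
    (hH : MDifferentiable 𝓘(ℝ, E) 𝓘(ℝ, ℝ) H) (hHG : ∀ (g : G) (y : M), H (g • y) = H y) (g : G)
    (y : M) : tangentMap g y (Ω.hamVF H y) = Ω.hamVF H (g • y) := by
  refine (Ω.exists_unique_dual (g • y) (differential H (g • y))).unique (fun w => ?_)
    (Ω.form_hamVF H (g • y))
  obtain ⟨v, rfl⟩ := tangentMap_surjective hG g y w
  rw [hΩ, Ω.form_hamVF]
  have h1 : (H ∘ fun z : M => g • z) = H := funext fun z => hHG g z
  have h2 := mfderiv_comp_apply y (hH (g • y)) (hG g y) v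
  rw [h1] at h2
  exact h2

theorem isMIntegralCurveOn_smul
    (hG : ∀ g : G, MDifferentiable 𝓘(ℝ, E) 𝓘(ℝ, E) (fun z : M => g • z))
    [FiniteDimensional ℝ E] {Ω : SymplecticForm E M}
    (hΩ : IsSymplecticAction G Ω) {H : M → ℝ}
    (hH : MDifferentiable 𝓘(ℝ, E) 𝓘(ℝ, ℝ) H) (hHG : ∀ (g : G) (y : M), H (g • y) = H y) (g : G)
    {γ : ℝ → M} {s : Set ℝ} (hγ : IsMIntegralCurveOn γ (Ω.hamVF H) s) :
    IsMIntegralCurveOn (fun t => g • γ t) (Ω.hamVF H) s := by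
  intro t ht
  have h1 := (hG g (γ t)).hasMFDerivAt
  have h2 := HasMFDerivAt.comp_hasMFDerivWithinAt t h1 (hγ t ht)
  refine h2.congr_mfderiv (ContinuousLinearMap.ext fun c => ?_)
  have h3 := (tangentMap (E := E) g (γ t)).map_smul c (Ω.hamVF H (γ t))
  rw [tangentMap_hamVF hG hΩ hH hHG] at h3
  exact h3

end Equivariance

/-! ### The isotropy group of the momentum and its orbits near `x` -/

section Isotropy

variable {E : Type*} [NormedAddCommGroup E] [NormedSpace ℝ E]
  {M : Type*} [TopologicalSpace M] [ChartedSpace E M]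
  {F : Type*} [NormedAddCommGroup F] [NormedSpace ℝ F]
  {G : Type*} [TopologicalSpace G] [ChartedSpace F G] [Group G] [MulAction G M]
  {Ω : SymplecticForm E M}

theorem MomentumMap.mem_isotropy_iff (P : MomentumMap F G Ω) (x : M) (g : G) :
    g ∈ P.isotropy (P.J x) ↔ P.J (g • x) = P.J x := by
  rw [P.equivariant]; rfl

theorem MomentumMap.mul_mem_isotropy (P : MomentumMap F G Ω) (x : M) {g h : G}
    (hg : g ∈ P.isotropy (P.J x)) (hh : h ∈ P.isotropy (P.J x)) :
    g * h ∈ P.isotropy (P.J x) := by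
  rw [mem_isotropy_iff] at hg hh ⊢
  rw [mul_smul, P.equivariant, hh, ← P.equivariant, hg]

theorem MomentumMap.inv_mem_isotropy (P : MomentumMap F G Ω) (x : M) {g : G}
    (hg : g ∈ P.isotropy (P.J x)) : g⁻¹ ∈ P.isotropy (P.J x) := by
  rw [mem_isotropy_iff] at hg ⊢
  have h := P.equivariant g⁻¹ (g • x)
  rw [hg, ← P.equivariant, inv_smul_smul] at h
  exact h.symm

theorem MomentumMap.one_mem_isotropy (P : MomentumMap F G Ω) (x : M) :
    (1 : G) ∈ P.isotropy (P.J x) := by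
  rw [mem_isotropy_iff, one_smul]

/-- Since `g` fixes μ under the affine action, the cocycle cancels: deviations from μ transform by
the linear coadjoint action, to which the boundedness hypothesis applies. -/
theorem MomentumMap.J_smul_sub (P : MomentumMap F G Ω) (x : M) {g : G}
    (hg : g ∈ P.isotropy (P.J x)) (y : M) :
    P.J (g • y) - P.J x = coAd g (P.J y - P.J x) := by
  have h : coAd g (P.J x) + P.c g = P.J x := hg
  have h2 : coAd g (P.J y - P.J x) = coAd g (P.J y) - coAd g (P.J x) := LinearMap.sub_comp _ _ _
  rw [h2, P.equivariant]
  nth_rewrite 1 [← h]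
  abel

variable [ContMDiffSMul 𝓘(ℝ, F) 𝓘(ℝ, E) ∞ G M]

theorem MomentumMap.contMDiff_J_orbit (P : MomentumMap F G Ω) (x : M) (ζ : LieAlg F G) :
    ContMDiff 𝓘(ℝ, F) 𝓘(ℝ, ℝ) ∞ (fun g : G => P.J (g • x) ζ) :=
  (P.smooth ζ).comp (contMDiff_smul_left x)

variable [LieGroup 𝓘(ℝ, F) ∞ G]

/-- By equivariance, J(gh·x) is an affine function of J(h·x). Differentiating in h at 1 along η
carries the vanishing at the identity over to every `g`. -/
theorem MomentumMap.differential_J_orbit (P : MomentumMap F G Ω) (x : M) (η : LieAlg F G)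
    (hη : ∀ ζ, differential (E := E) (fun z => P.J z ζ) x (infAction x η) = 0) (ζ : LieAlg F G)
    (g : G) :
    differential (E := F) (fun g : G => P.J (g • x) ζ) g (mulInvariantVectorField η g) = 0 := by
  have hJ (ζ : LieAlg F G) : MDifferentiable 𝓘(ℝ, F) 𝓘(ℝ, ℝ) (fun g : G => P.J (g • x) ζ) :=
    (P.contMDiff_J_orbit x ζ).mdifferentiable (by simp)
  -- the derivative at the identity
  have h1 (ζ : LieAlg F G) : mfderiv 𝓘(ℝ, F) 𝓘(ℝ, ℝ) (fun g : G => P.J (g • x) ζ) 1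
      η = (0 : ℝ) := by
    have h2 : MDifferentiableAt 𝓘(ℝ, F) 𝓘(ℝ, E) (fun g : G => g • x) 1 :=
      (contMDiff_smul_left x).mdifferentiableAt (by simp)
    have h3 := mfderiv_comp_apply (I := 𝓘(ℝ, F)) (I' := 𝓘(ℝ, E)) (I'' := 𝓘(ℝ, ℝ)) (1 : G)
      ((P.smooth ζ).mdifferentiable (by simp) ((1 : G) • x)) h2 η
    have h4 := mfderiv_congr_point (I := 𝓘(ℝ, E)) (I' := 𝓘(ℝ, ℝ)) (f := fun z => P.J z ζ)
      (one_smul G x)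
    have h5 := DFunLike.congr_fun h4 (infAction x η : E)
    exact h3.trans (h5.trans (hη ζ))
  have hL : MDifferentiableAt 𝓘(ℝ, F) 𝓘(ℝ, F) (fun h : G => g * h) 1 :=
    (contMDiff_mul_left (I := 𝓘(ℝ, F)) (n := ∞)).mdifferentiableAt (by simp)
  have h3 := mfderiv_comp_apply (I := 𝓘(ℝ, F)) (I' := 𝓘(ℝ, F)) (I'' := 𝓘(ℝ, ℝ)) (1 : G)
    (hJ ζ (g * 1)) hL η
  have h4 := mfderiv_congr_point (I := 𝓘(ℝ, F)) (I' := 𝓘(ℝ, ℝ)) (f := fun g : G => P.J (g • x) ζ)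
      (mul_one g)
  have h5 := DFunLike.congr_fun h4 (mulInvariantVectorField η g : F)
  have h6 : (fun g : G => P.J (g • x) ζ) ∘ (fun h : G => g * h) =
      fun h => P.J (h • x) (Ad (F := F) g⁻¹ ζ) + P.c g ζ := by
    funext h
    change P.J ((g * h) • x) ζ = _
    rw [mul_smul, P.equivariant]
    rfl
  have h7 : mfderiv 𝓘(ℝ, F) 𝓘(ℝ, ℝ) ((fun g : G => P.J (g • x) ζ) ∘ (fun h : G => g * h)) 1 η
      = (0 : ℝ) := by
    rw [h6]
    have h8 := ((hJ (Ad (F := F) g⁻¹ ζ) 1).hasMFDerivAt.add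
      (hasMFDerivAt_const (P.c g ζ) (1 : G))).mfderiv
    have h9 := DFunLike.congr_fun h8 η
    exact h9.trans ((add_zero _).trans (h1 _))
  exact h5.symm.trans (h3.symm.trans h7)

/-- The integral curve through 1 of the left-invariant field of η keeps J(g·x) constant, hence lies
in G_μ. Tangent directions of G_μ are thus realized by curves without knowing that G_μ is a
submanifold. -/
theorem MomentumMap.exists_curve_isotropy [FiniteDimensional ℝ F] (P : MomentumMap F G Ω)
    (x : M) (η : LieAlg F G)
    (hη : ∀ ζ, differential (E := E) (fun z => P.J z ζ) x (infAction x η) = 0) :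
    ∃ g : ℝ → G, g 0 = 1 ∧ ContMDiffAt 𝓘(ℝ, ℝ) 𝓘(ℝ, F) 1 g 0 ∧
      HasMFDerivAt 𝓘(ℝ, ℝ) 𝓘(ℝ, F) g 0 ((1 : ℝ →L[ℝ] ℝ).smulRight (η : F)) ∧
      ∀ᶠ t in 𝓝 0, g t ∈ P.isotropy (P.J x) := by
  have : LieGroup 𝓘(ℝ, F) (minSmoothness ℝ 3) G := by
    rw [minSmoothness_of_isRCLikeNormedField]
    exact LieGroup.of_le (n := ∞) (by norm_cast)
  have : CompleteSpace F := FiniteDimensional.complete ℝ F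
  have hX : ContMDiffAt 𝓘(ℝ, F) 𝓘(ℝ, F).tangent 1
      (fun g : G => (⟨g, mulInvariantVectorField η g⟩ : TangentBundle 𝓘(ℝ, F) G)) 1 :=
    (contMDiffAt_mulInvariantVectorField η).of_le (by
      rw [minSmoothness_of_isRCLikeNormedField]; norm_cast)
  obtain ⟨g, hg0, hg, hg1⟩ := exists_contMDiffAt_integralCurve hX
  refine ⟨g, hg0, hg1, ?_, ?_⟩
  · have h1 := hg.hasMFDerivAt
    have h2 : (mulInvariantVectorField η (g 0) : F) = η := by
      rw [hg0]
      have h3 : (fun h : G => 1 * h) = id := funext fun h => one_mul h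
      have h4 : mulInvariantVectorField (I := 𝓘(ℝ, F)) η (1 : G) =
        mfderiv 𝓘(ℝ, F) 𝓘(ℝ, F) (fun h : G => 1 * h) 1 η := rfl
      rw [h4]
      have h5 : HasMFDerivAt 𝓘(ℝ, F) 𝓘(ℝ, F) (fun h : G => 1 * h) 1
        (ContinuousLinearMap.id ℝ F) := by
        rw [h3]; exact hasMFDerivAt_id _
      have h6 := h5.mfderiv
      exact DFunLike.congr_fun h6 η
    refine h1.congr_mfderiv (ContinuousLinearMap.ext fun (c : ℝ) => ?_)
    exact congrArg (fun w : F => c • w) h2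
  · obtain ⟨ε, hε, hc⟩ := isMIntegralCurveAt_iff'.1 hg
    rw [Real.ball_eq_Ioo] at hc
    filter_upwards [Ioo_mem_nhds (show 0 - ε < 0 by linarith)
      (show 0 < 0 + ε by linarith)] with t ht
    rw [mem_isotropy_iff]
    refine LinearMap.ext fun ζ => ?_
    have := eqOn_integralCurve_of_differential_eq_zero (f := fun g : G => P.J (g • x) ζ)
      ((P.contMDiff_J_orbit x ζ).mdifferentiable (by simp))
      (fun k => P.differential_J_orbit x η hη ζ k) ⟨by linarith, by linarith⟩ hc ht
    rw [hg0, one_smul] at this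
    exact this

variable [FiniteDimensional ℝ F]

/-- Enlarging a germ of a map into `M` by a one-parameter family of elements of the isotropy
group. -/
theorem MomentumMap.exists_enlarge_germ (P : MomentumMap F G Ω) (x : M) (η : LieAlg F G)
    (hη : ∀ ζ, differential (E := E) (fun z => P.J z ζ) x (infAction x η) = 0)
    {V : Type*} [NormedAddCommGroup V] [NormedSpace ℝ V] {ψ : V → M} (hψ0 : ψ 0 = x)
    (hψ : ContMDiffAt 𝓘(ℝ, V) 𝓘(ℝ, E) 1 ψ 0) :
    ∃ ψ' : ℝ × V → M, ψ' 0 = x ∧ ContMDiffAt 𝓘(ℝ, ℝ × V) 𝓘(ℝ, E) 1 ψ' 0 ∧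
      (∀ᶠ p in 𝓝 (0 : ℝ × V), ∃ k ∈ P.isotropy (P.J x), ψ' p = k • ψ p.2) ∧
      (∀ v : V, (mfderiv 𝓘(ℝ, ℝ × V) 𝓘(ℝ, E) ψ' 0 ((0, v) : ℝ × V) : E) =
        (mfderiv 𝓘(ℝ, V) 𝓘(ℝ, E) ψ 0 v : E)) ∧
      (mfderiv 𝓘(ℝ, ℝ × V) 𝓘(ℝ, E) ψ' 0 ((1, 0) : ℝ × V) : E) = (infAction x η : E) := by
  obtain ⟨g, hg0, hg1, hgd, hgK⟩ := P.exists_curve_isotropy x η hη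
  have hsm : ContMDiffAt 𝓘(ℝ, ℝ × V) 𝓘(ℝ, E) 1 (fun p : ℝ × V => g p.1 • ψ p.2) 0 := by
    have h1 : ContMDiffAt 𝓘(ℝ, ℝ × V) 𝓘(ℝ, F) 1 (fun p : ℝ × V => g p.1) 0 :=
      ContMDiffAt.comp (I' := 𝓘(ℝ, ℝ)) (0 : ℝ × V) (g := g) (f := Prod.fst) hg1
        contDiff_fst.contMDiff.contMDiffAt
    have h2 : ContMDiffAt 𝓘(ℝ, ℝ × V) 𝓘(ℝ, E) 1 (fun p : ℝ × V => ψ p.2) 0 :=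
      ContMDiffAt.comp (I' := 𝓘(ℝ, V)) (0 : ℝ × V) (g := ψ) (f := Prod.snd) hψ
        contDiff_snd.contMDiff.contMDiffAt
    have h3 : ContMDiffAt (𝓘(ℝ, F).prod 𝓘(ℝ, E)) 𝓘(ℝ, E) 1 (fun p : G × M => p.1 • p.2)
        (g 0, ψ 0) := (contMDiff_smul_pair.of_le (by norm_cast)).contMDiffAt
    exact ContMDiffAt.comp (0 : ℝ × V) (g := fun p : G × M => p.1 • p.2)
      (f := fun p : ℝ × V => (g p.1, ψ p.2)) h3 (h1.prodMk h2)
  have hd := (hsm.mdifferentiableAt one_ne_zero).hasMFDerivAt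
  refine ⟨fun p => g p.1 • ψ p.2, ?_, hsm, ?_, fun v => ?_, ?_⟩
  · change g 0 • ψ 0 = x
    rw [hg0, hψ0, one_smul]
  · have : ∀ᶠ p in 𝓝 (0 : ℝ × V), g p.1 ∈ P.isotropy (P.J x) :=
      (continuous_fst.tendsto (0 : ℝ × V)).eventually hgK
    exact this.mono fun p hp => ⟨_, hp, rfl⟩
  · have h1 : HasMFDerivAt 𝓘(ℝ, V) 𝓘(ℝ, ℝ × V) (fun w : V => ((0, w) : ℝ × V)) 0
        (ContinuousLinearMap.inr ℝ ℝ V) := (ContinuousLinearMap.inr ℝ ℝ V).hasMFDerivAt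
    have h2 := HasMFDerivAt.comp (0 : V) (f := fun w : V => ((0, w) : ℝ × V))
      (g := fun p : ℝ × V => g p.1 • ψ p.2) hd h1
    have h3 : (fun p : ℝ × V => g p.1 • ψ p.2) ∘ (fun w : V => ((0, w) : ℝ × V)) = ψ := by
      funext w
      change g 0 • ψ w = ψ w
      rw [hg0, one_smul]
    have h4 := h2.mfderiv
    rw [h3] at h4
    exact (DFunLike.congr_fun h4 v).symm
  · have h1 : HasMFDerivAt 𝓘(ℝ, ℝ) 𝓘(ℝ, ℝ × V) (fun t : ℝ => ((t, 0) : ℝ × V)) 0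
        (ContinuousLinearMap.inl ℝ ℝ V) := (ContinuousLinearMap.inl ℝ ℝ V).hasMFDerivAt
    have h2 := HasMFDerivAt.comp (0 : ℝ) (f := fun t : ℝ => ((t, 0) : ℝ × V))
      (g := fun p : ℝ × V => g p.1 • ψ p.2) hd h1
    have h3 : (fun p : ℝ × V => g p.1 • ψ p.2) ∘ (fun t : ℝ => ((t, 0) : ℝ × V)) =
        (fun k : G => k • x) ∘ g := by
      funext t
      change g t • ψ 0 = g t • x
      rw [hψ0]
    have h5 : HasMFDerivAt 𝓘(ℝ, F) 𝓘(ℝ, E) (fun k : G => k • x) (g 0)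
        (mfderiv 𝓘(ℝ, F) 𝓘(ℝ, E) (fun k : G => k • x) (g 0)) :=
      ((contMDiff_smul_left x).mdifferentiableAt (by simp)).hasMFDerivAt
    have h6 := HasMFDerivAt.comp (0 : ℝ) h5 hgd
    rw [h3] at h2
    have h7 := DFunLike.congr_fun (hasMFDerivAt_unique h2 h6) (1 : ℝ)
    have h8 := DFunLike.congr_fun (mfderiv_congr_point (I := 𝓘(ℝ, F)) (I' := 𝓘(ℝ, E))
      (f := fun k : G => k • x) hg0) (η : F)
    refine h7.trans (Eq.trans ?_ h8)
    exact congrArg (mfderiv 𝓘(ℝ, F) 𝓘(ℝ, E) (fun k : G => k • x) (g 0)) (one_smul ℝ (η : F))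

/-- Iterating the enlargement adds one real parameter per generator, while every value of the germ
remains a G_μ-translate of a point of `σ`. -/
theorem MomentumMap.exists_germ_of_list.{u} (P : MomentumMap F G Ω) (x : M) {V₀ : Type u}
    [NormedAddCommGroup V₀] [NormedSpace ℝ V₀] [FiniteDimensional ℝ V₀] {σ : V₀ → M}
    (hσ0 : σ 0 = x) (hσ : ContMDiffAt 𝓘(ℝ, V₀) 𝓘(ℝ, E) 1 σ 0) (l : List (LieAlg F G))
    (hl : ∀ η ∈ l, ∀ ζ, differential (E := E) (fun z => P.J z ζ) x (infAction x η) = 0) :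
    ∃ (V : Type u) (_ : NormedAddCommGroup V) (_ : NormedSpace ℝ V) (_ : FiniteDimensional ℝ V)
      (ψ : V → M), ψ 0 = x ∧ ContMDiffAt 𝓘(ℝ, V) 𝓘(ℝ, E) 1 ψ 0 ∧
      (∀ B ∈ 𝓝 (0 : V₀), ∀ᶠ v in 𝓝 (0 : V), ∃ k ∈ P.isotropy (P.J x), ∃ p ∈ B, ψ v = k • σ p) ∧
      (∀ w : V₀, ∃ v : V, (mfderiv 𝓘(ℝ, V) 𝓘(ℝ, E) ψ 0 v : E) =
        (mfderiv 𝓘(ℝ, V₀) 𝓘(ℝ, E) σ 0 w : E)) ∧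
      ∀ η ∈ l, ∃ v : V, (mfderiv 𝓘(ℝ, V) 𝓘(ℝ, E) ψ 0 v : E) = (infAction x η : E) := by
  induction l with
  | nil =>
    refine ⟨V₀, inferInstance, inferInstance, inferInstance, σ, hσ0, hσ, fun B hB => ?_,
      fun w => ⟨w, rfl⟩, fun η hη => absurd hη List.not_mem_nil⟩
    filter_upwards [hB] with v hv
    exact ⟨1, P.one_mem_isotropy x, v, hv, (one_smul G _).symm⟩
  | cons η l ih =>
    obtain ⟨V, i1, i2, i3, ψ, hψ0, hψ, hK, hw, hη⟩ := ih
        fun η' h => hl η' (List.mem_cons_of_mem _ h)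
    obtain ⟨ψ', hψ'0, hψ', hK', hv', h1'⟩ :=
      P.exists_enlarge_germ x η (hl η List.mem_cons_self) hψ0 hψ
    refine ⟨ℝ × V, inferInstance, inferInstance, inferInstance, ψ', hψ'0, hψ', fun B hB => ?_,
      fun w => ?_, fun η' h => ?_⟩
    · have h2 : ∀ᶠ p in 𝓝 (0 : ℝ × V), ∃ k ∈ P.isotropy (P.J x), ∃ q ∈ B, ψ p.2 = k • σ q :=
        (continuous_snd.tendsto (0 : ℝ × V)).eventually (hK B hB)
      filter_upwards [hK', h2] with p ⟨k, hk, e1⟩ ⟨k', hk', q, hq, e2⟩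
      exact ⟨k * k', P.mul_mem_isotropy x hk hk', q, hq, by rw [e1, e2, mul_smul]⟩
    · obtain ⟨v, hv⟩ := hw w
      exact ⟨(0, v), (hv' v).trans hv⟩
    · rcases List.mem_cons.1 h with rfl | h
      · exact ⟨(1, 0), h1'⟩
      · obtain ⟨v, hv⟩ := hη η' h
        exact ⟨(0, v), (hv' v).trans hv⟩

variable [FiniteDimensional ℝ E] [IsManifold 𝓘(ℝ, E) ∞ M]

/-- A `C¹` germ with surjective derivative maps neighbourhoods onto neighbourhoods. -/
theorem eventually_of_germ_surjective {V : Type*} [NormedAddCommGroup V] [NormedSpace ℝ V]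
    [FiniteDimensional ℝ V] {x : M} {ψ : V → M} (hψ0 : ψ 0 = x)
    (hψ : ContMDiffAt 𝓘(ℝ, V) 𝓘(ℝ, E) 1 ψ 0)
    (hs : ∀ u : E, ∃ v : V, (mfderiv 𝓘(ℝ, V) 𝓘(ℝ, E) ψ 0 v : E) = u) {S : Set M}
    (hS : ∀ᶠ v in 𝓝 (0 : V), ψ v ∈ S) : S ∈ 𝓝 x := by
  subst hψ0
  set e := chartAt E (ψ 0) with he
  have hsrc : ψ 0 ∈ e.source := mem_chart_source E (ψ 0)
  have h1 : ContMDiffAt 𝓘(ℝ, V) 𝓘(ℝ, E) 1 (fun v => e (ψ v)) 0 :=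
    ContMDiffAt.comp (0 : V) (contMDiffAt_chartAt (ψ 0) hsrc) hψ
  have h2 : HasStrictFDerivAt (fun v => e (ψ v)) (fderiv ℝ (fun v => e (ψ v)) 0) 0 :=
    h1.contDiffAt.hasStrictFDerivAt one_ne_zero
  have hrange : (fderiv ℝ (fun v => e (ψ v)) 0).range = ⊤ := by
    rw [LinearMap.range_eq_top]
    intro u
    obtain ⟨v, hv⟩ := hs (mfderiv 𝓘(ℝ, E) 𝓘(ℝ, E) e.symm (e (ψ 0)) u)
    refine ⟨v, ?_⟩
    have h3 := mfderiv_comp_apply (0 : V) (mdifferentiableAt_chartAt (ψ 0) hsrc)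
      (hψ.mdifferentiableAt one_ne_zero) v
    rw [mfderiv_eq_fderiv] at h3
    have h4 := mfderiv_chartAt_comp_symm (ψ 0) (mem_chart_target E (ψ 0)) u
    have h5 := mfderiv_congr_point (I := 𝓘(ℝ, E)) (I' := 𝓘(ℝ, E)) (f := e) (e.left_inv hsrc)
    have h6 := DFunLike.congr_fun h5 (mfderiv 𝓘(ℝ, V) 𝓘(ℝ, E) ψ 0 v : E)
    refine h3.trans (h6.symm.trans (Eq.trans ?_ h4))
    exact congrArg (mfderiv 𝓘(ℝ, E) 𝓘(ℝ, E) e (e.symm (e (ψ 0)))) hv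
  have : CompleteSpace V := FiniteDimensional.complete ℝ V
  have : CompleteSpace E := FiniteDimensional.complete ℝ E
  have h3 := h2.map_nhds_eq_of_surj hrange
  have h4 : ∀ᶠ u in 𝓝 (e (ψ 0)), e.symm u ∈ S := by
    rw [← h3, eventually_map]
    filter_upwards [hS, hψ.continuousAt.eventually (e.open_source.mem_nhds hsrc)] with v hv hv'
    rwa [e.left_inv hv']
  filter_upwards [(e.continuousAt hsrc).eventually h4, e.open_source.mem_nhds hsrc] with y hy hy'
  rwa [e.left_inv hy'] at hy

/-- Multiplying `σ` by curves in G_μ for finitely many spanning generators gives a germ with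
surjective derivative at 0; such a germ is open at 0, and its values are translates of `σ`. -/
theorem MomentumMap.isotropy_smul_mem_nhds.{u} (P : MomentumMap F G Ω) (x : M) {V₀ : Type u}
    [NormedAddCommGroup V₀] [NormedSpace ℝ V₀] [FiniteDimensional ℝ V₀] {σ : V₀ → M}
    (hσ0 : σ 0 = x) (hσ : ContMDiffAt 𝓘(ℝ, V₀) 𝓘(ℝ, E) 1 σ 0)
    (hspan : ∀ u : E, ∃ (η : LieAlg F G) (w : V₀),
      (∀ ζ, differential (E := E) (fun z => P.J z ζ) x (infAction x η) = 0) ∧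
        ∃ a b : E, a = infAction x η ∧ b = mfderiv 𝓘(ℝ, V₀) 𝓘(ℝ, E) σ 0 w ∧ u = a + b)
    {B : Set V₀} (hB : B ∈ 𝓝 0) :
    {y | ∃ k ∈ P.isotropy (P.J x), ∃ p ∈ B, y = k • σ p} ∈ 𝓝 x := by
  let A : F →L[ℝ] E := infAction (F := F) (G := G) (E := E) x
  -- All η with η_M(x) in Ker dJ(x): the infinitesimal version of G_μ. A finite generating set is
  -- enough.
  let L : Submodule ℝ F :=
    ⨅ ζ : LieAlg F G,
      ((differential (E := E) (fun z => P.J z ζ) x : E →L[ℝ] ℝ) ∘L A).toLinearMap.ker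
  have hL (η : F) : η ∈ L ↔ ∀ ζ : LieAlg F G, differential (E := E) (fun z => P.J z ζ) x
      (infAction (F := F) (G := G) x η) = 0 := by
    rw [Submodule.mem_iInf]; rfl
  obtain ⟨s, hs⟩ := (IsNoetherian.noetherian L : L.FG)
  have hsL (η : F) (h : η ∈ s.toList) : η ∈ L := hs ▸ Submodule.subset_span (Finset.mem_toList.1 h)
  obtain ⟨V, i1, i2, i3, ψ, hψ0, hψ, hK, hw, hη⟩ := P.exists_germ_of_list x hσ0 hσ s.toList
    fun η h => (hL η).1 (hsL η h)
  let D : V →L[ℝ] E := mfderiv 𝓘(ℝ, V) 𝓘(ℝ, E) ψ 0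
  have hmap : L.map A.toLinearMap ≤ D.range := by
    rw [← hs, Submodule.map_span, Submodule.span_le]
    rintro _ ⟨η, h, rfl⟩
    exact hη η (Finset.mem_toList.2 h)
  refine eventually_of_germ_surjective hψ0 hψ (fun u => ?_) (hK B hB)
  obtain ⟨η, w, h1, a, b, ha, hb, rfl⟩ := hspan u
  obtain ⟨v1, hv1⟩ := hmap ⟨η, (hL η).2 h1, rfl⟩
  obtain ⟨v2, hv2⟩ := hw w
  refine ⟨v1 + v2, ?_⟩
  have h3 := D.map_add v1 v2
  refine h3.trans ?_
  exact congrArg₂ (fun a b : E => a + b) (hv1.trans ha.symm) (hv2.trans hb.symm)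

end Isotropy

/-! ### The thickened slice as a section -/

section Section

variable {E : Type*} [NormedAddCommGroup E] [NormedSpace ℝ E]
  {M : Type*} [TopologicalSpace M] [ChartedSpace E M]

/-- Thickening a germ `φ` into `M` in the directions of `Z`. -/
theorem exists_thickening [IsManifold 𝓘(ℝ, E) ∞ M] {W Z : Type*}
    [NormedAddCommGroup W] [NormedSpace ℝ W]
    [NormedAddCommGroup Z] [NormedSpace ℝ Z] {φ : W → M}
    (hφ : ContMDiffAt 𝓘(ℝ, W) 𝓘(ℝ, E) ∞ φ 0) (ι : Z →L[ℝ] E) :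
    ∃ σ : W × Z → M, ContMDiffAt 𝓘(ℝ, W × Z) 𝓘(ℝ, E) ∞ σ 0 ∧
      (∀ᶠ w in 𝓝 (0 : W), σ (w, 0) = φ w) ∧
      (∀ w : W, (mfderiv 𝓘(ℝ, W × Z) 𝓘(ℝ, E) σ 0 ((w, 0) : W × Z) : E) =
        (mfderiv 𝓘(ℝ, W) 𝓘(ℝ, E) φ 0 w : E)) ∧
      (∀ z : Z, (mfderiv 𝓘(ℝ, W × Z) 𝓘(ℝ, E) σ 0 ((0, z) : W × Z) : E) = ι z) := by
  set e := chartAt E (φ 0) with he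
  have hsrc : φ 0 ∈ e.source := mem_chart_source E (φ 0)
  have htar : e (φ 0) ∈ e.target := mem_chart_target E (φ 0)
  let T : E →L[ℝ] E := mfderiv 𝓘(ℝ, E) 𝓘(ℝ, E) e (φ 0)
  -- Displacement in the chart by the image of `ι z` under the chart derivative, so that returning
  -- to M differentiates to `ι` itself in the Z directions.
  let τ : W × Z → E := fun p => e (φ p.1) + T (ι p.2)
  have hτ0 : τ 0 = e (φ 0) := by
    change e (φ 0) + T (ι 0) = _
    rw [map_zero, map_zero, add_zero]
  have hτ : ContDiffAt ℝ ∞ τ 0 := by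
    have h1 : ContMDiffAt 𝓘(ℝ, W) 𝓘(ℝ, E) ∞ (fun w => e (φ w)) 0 :=
      ContMDiffAt.comp (0 : W) (contMDiffAt_chartAt (φ 0) hsrc) hφ
    have h2 : ContDiffAt ℝ ∞ (fun p : W × Z => e (φ p.1)) 0 :=
      ContDiffAt.comp (0 : W × Z) (g := fun w => e (φ w)) h1.contDiffAt contDiffAt_fst
    exact h2.add ((T ∘L ι).contDiff.contDiffAt.comp _ contDiffAt_snd)
  have hσ : ContMDiffAt 𝓘(ℝ, W × Z) 𝓘(ℝ, E) ∞ (fun p => e.symm (τ p)) 0 := by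
    refine ContMDiffAt.comp (0 : W × Z) (g := e.symm) ?_ hτ.contMDiffAt
    rw [hτ0]
    exact contMDiffAt_chartAt_symm (φ 0) htar
  have hinl : ∀ᶠ w in 𝓝 (0 : W), e.symm (τ (w, 0)) = φ w := by
    filter_upwards [hφ.continuousAt.eventually (e.open_source.mem_nhds hsrc)] with w hw
    change e.symm (e (φ w) + T (ι 0)) = φ w
    rw [map_zero, map_zero, add_zero, e.left_inv hw]
  have hd := (hσ.mdifferentiableAt (by simp)).hasMFDerivAt
  refine ⟨fun p => e.symm (τ p), hσ, hinl, fun w => ?_, fun z => ?_⟩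
  · have h1 : HasMFDerivAt 𝓘(ℝ, W) 𝓘(ℝ, W × Z) (fun w : W => ((w, 0) : W × Z)) 0
        (ContinuousLinearMap.inl ℝ W Z) := (ContinuousLinearMap.inl ℝ W Z).hasMFDerivAt
    have h2 := HasMFDerivAt.comp (0 : W) (f := fun w : W => ((w, 0) : W × Z))
      (g := fun p : W × Z => e.symm (τ p)) hd h1
    have h3 := (h2.congr_of_eventuallyEq (hinl.mono fun _ h => h.symm)).mfderiv
    exact (DFunLike.congr_fun h3 w).symm
  · have h1 : HasMFDerivAt 𝓘(ℝ, Z) 𝓘(ℝ, W × Z) (fun z : Z => ((0, z) : W × Z)) 0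
        (ContinuousLinearMap.inr ℝ W Z) := (ContinuousLinearMap.inr ℝ W Z).hasMFDerivAt
    have h2 := HasMFDerivAt.comp (0 : Z) (f := fun z : Z => ((0, z) : W × Z))
      (g := fun p : W × Z => e.symm (τ p)) hd h1
    have h4 : HasMFDerivAt 𝓘(ℝ, Z) 𝓘(ℝ, E) (fun z : Z => τ (0, z)) 0 (T ∘L ι) := by
      have : HasFDerivAt (fun z : Z => e (φ 0) + (T ∘L ι) z) (T ∘L ι) 0 :=
        (T ∘L ι).hasFDerivAt.const_add _
      exact this.hasMFDerivAt
    have h5 : MDifferentiableAt 𝓘(ℝ, E) 𝓘(ℝ, E) e.symm (τ (0, 0)) := by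
      change MDifferentiableAt 𝓘(ℝ, E) 𝓘(ℝ, E) e.symm (τ 0)
      rw [hτ0]
      exact mdifferentiableAt_chartAt_symm (φ 0) htar
    have h6 := HasMFDerivAt.comp (0 : Z) (f := fun z : Z => τ (0, z)) h5.hasMFDerivAt h4
    have h7 := DFunLike.congr_fun (hasMFDerivAt_unique h2 h6) z
    have h8 := DFunLike.congr_fun (mfderiv_congr_point (I := 𝓘(ℝ, E)) (I' := 𝓘(ℝ, E))
      (f := e.symm) hτ0) (T (ι z))
    exact h7.trans (h8.trans (mfderiv_chartAt_symm_comp (φ 0) hsrc (ι z)))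

variable {F : Type*} [NormedAddCommGroup F] [NormedSpace ℝ F]
  {G : Type*} [TopologicalSpace G] [ChartedSpace F G] [Group G] [MulAction G M]
  {Ω : SymplecticForm E M}

/-- Near `0`, a thickening `σ` of a germ in the level set `J⁻¹(J x)` in directions transverse to
`Ker dJ(x)` meets the level set only in the image of the germ. -/
theorem MomentumMap.eventually_snd_eq_zero [FiniteDimensional ℝ F]
    {W Z : Type*} [NormedAddCommGroup W] [NormedSpace ℝ W]
    [FiniteDimensional ℝ W] [NormedAddCommGroup Z] [NormedSpace ℝ Z] [FiniteDimensional ℝ Z]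
    (P : MomentumMap F G Ω) {x : M}
    {σ : W × Z → M} (hσ0 : σ 0 = x) (hσ : ContMDiffAt 𝓘(ℝ, W × Z) 𝓘(ℝ, E) ∞ σ 0)
    (hlevel : ∀ᶠ w in 𝓝 (0 : W), P.J (σ (w, 0)) = P.J x) {D : W × Z →L[ℝ] E}
    (hD : (mfderiv 𝓘(ℝ, W × Z) 𝓘(ℝ, E) σ 0 : W × Z →L[ℝ] E) = D)
    (hz : ∀ z : Z, (∀ ζ, differential (E := E) (fun y => P.J y ζ) x (D (0, z)) = 0) → z = 0) :
    ∀ᶠ p in 𝓝 (0 : W × Z), P.J (σ p) = P.J x → p.2 = 0 := by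
  subst hσ0
  have : FiniteDimensional ℝ (LieAlg F G) := inferInstanceAs (FiniteDimensional ℝ F)
  let b := Module.finBasis ℝ (LieAlg F G)
  let n := Module.finrank ℝ (LieAlg F G)
  let d : Fin n → (E →L[ℝ] ℝ) := fun i => differential (E := E) (fun y => P.J y (b i)) (σ 0)
  have hQi (i : Fin n) : HasStrictFDerivAt (fun p => P.J (σ p) (b i)) ((d i) ∘L D) 0 := by
    have h1 : ContMDiffAt 𝓘(ℝ, W × Z) 𝓘(ℝ, ℝ) ∞ (fun p => P.J (σ p) (b i)) 0 :=
      ContMDiffAt.comp (0 : W × Z) (P.smooth (b i)).contMDiffAt hσ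
    have h2 := h1.contDiffAt.hasStrictFDerivAt (by simp)
    have h3 := HasMFDerivAt.comp (0 : W × Z) (g := fun y => P.J y (b i))
      ((P.smooth (b i)).mdifferentiableAt (by simp)).hasMFDerivAt
      (hσ.mdifferentiableAt (by simp)).hasMFDerivAt
    have h4 : HasMFDerivAt 𝓘(ℝ, W × Z) 𝓘(ℝ, ℝ) (fun p => P.J (σ p) (b i)) 0 ((d i) ∘L D) :=
      h3.congr_mfderiv (congrArg (fun L : W × Z →L[ℝ] E => (d i) ∘L L) hD)
    have h5 : HasFDerivAt (fun p => P.J (σ p) (b i)) ((d i) ∘L D) 0 := h4.hasFDerivAt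
    exact h2.congr_fderiv h5.fderiv
  let Q : W × Z → (Fin n → ℝ) := fun p i => P.J (σ p) (b i)
  let A : W × Z →L[ℝ] (Fin n → ℝ) := ContinuousLinearMap.pi fun i => (d i) ∘L D
  have hQ : HasStrictFDerivAt Q A 0 := hasStrictFDerivAt_pi.2 hQi
  have hA1 (w : W) : A (w, 0) = 0 := by
    have h1 : HasFDerivAt (fun w : W => Q (w, 0)) (A ∘L ContinuousLinearMap.inl ℝ W Z) 0 :=
      HasFDerivAt.comp (0 : W) (g := Q) hQ.hasFDerivAt
        (ContinuousLinearMap.inl ℝ W Z).hasFDerivAt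
    have h2 : HasFDerivAt (fun w : W => Q (w, 0)) (0 : W →L[ℝ] (Fin n → ℝ)) 0 := by
      refine (hasFDerivAt_const (fun i => P.J (σ 0) (b i)) (0 : W)).congr_of_eventuallyEq ?_
      filter_upwards [hlevel] with w hw
      funext i
      exact LinearMap.congr_fun hw (b i)
    exact DFunLike.congr_fun (h1.unique h2) w
  have hA2 : LinearMap.ker (A.toLinearMap ∘ₗ LinearMap.inr ℝ W Z) = ⊥ := by
    rw [LinearMap.ker_eq_bot']
    intro z h0
    refine hz z fun ζ => ?_
    -- The momentum map identity exhibits d⟨J, ζ⟩ as linear in ζ, so vanishing on a basis suffices.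
    let l : LieAlg F G →ₗ[ℝ] ℝ :=
      (((flatMap (E := E) (Ω.form (σ 0))).flip (D (0, z))) ∘L
        (infAction (F := F) (G := G) (E := E) (σ 0) : LieAlg F G →L[ℝ] E)).toLinearMap
    have hl (ζ : LieAlg F G) :
        differential (E := E) (fun y => P.J y ζ) (σ 0) (D (0, z)) = l ζ := by
      exact (P.hamiltonian ζ (σ 0) (D (0, z))).symm.trans (flatMap_apply (E := E) _ _ _).symm
    rw [hl]
    have : l = 0 := b.ext fun i => (hl (b i)).symm.trans (congrFun h0 i)
    rw [this]; rfl
  obtain ⟨g, hg⟩ := LinearMap.exists_leftInverse_of_injective _ hA2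
  -- Composing J ∘ σ with a left inverse of its derivative in the Z directions gives a map with
  -- derivative the identity at 0, hence injective nearby. It agrees at p and (p.1, 0) when both lie
  -- over μ.
  have hT : HasStrictFDerivAt (fun p : W × Z => (p.1, g.toContinuousLinearMap (Q p)))
      ((ContinuousLinearEquiv.refl ℝ (W × Z) : (W × Z) ≃L[ℝ] (W × Z)) : W × Z →L[ℝ] W × Z) 0 := by
    have h1 := (hasStrictFDerivAt_fst (𝕜 := ℝ) (E := W) (F := Z) (p := 0)).prodMk
      (g.toContinuousLinearMap.hasStrictFDerivAt.comp (0 : W × Z) hQ)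
    refine h1.congr_fderiv (ContinuousLinearMap.ext fun p => ?_)
    refine Prod.ext rfl ?_
    change g (A p) = p.2
    have h2 : p = (p.1, 0) + (0, p.2) := by simp
    have h3 : g (A (0, p.2)) = p.2 := LinearMap.congr_fun hg p.2
    rw [h2, map_add, hA1, zero_add, h3]
    simp
  have hcf : ContinuousAt (fun p : W × Z => ((p.1, 0) : W × Z)) 0 := by fun_prop
  have hcf' : Tendsto (fun p : W × Z => ((p.1, 0) : W × Z)) (𝓝 0) (𝓝 0) := hcf
  filter_upwards [hT.eventually_left_inverse, hcf'.eventually hT.eventually_left_inverse,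
    (continuous_fst.tendsto (0 : W × Z)).eventually hlevel] with p h1 h2 h3 hp
  have h4 : Q p = Q (p.1, 0) := funext fun i => by
    change P.J (σ p) (b i) = P.J (σ (p.1, 0)) (b i)
    rw [hp, h3]
  simp only [h4] at h1
  have h5 : p = (p.1, 0) := h1.symm.trans h2
  exact congrArg Prod.snd h5

theorem MomentumMap.IsSliceParametrization.finiteDimensional [FiniteDimensional ℝ E]
    {W : Type*} [NormedAddCommGroup W]
    [NormedSpace ℝ W] {P : MomentumMap F G Ω} {x : M} {N : Submodule ℝ (TangentSpace 𝓘(ℝ, E) x)}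
    {φ : W → M} (hφ : P.IsSliceParametrization x N φ) : FiniteDimensional ℝ W := by
  obtain ⟨L, hL, -, -⟩ := hφ.tangent
  let L' : W →L[ℝ] E := L
  exact FiniteDimensional.of_injective L'.toLinearMap hL

/-- The slice parametrization extends to a section `σ` of the action of the isotropy group near `x`
such that `x` is an isolated point, in the image of `σ`, of the part of the level set of `J` on
which the augmented Hamiltonian is at most its value at `x`. -/
theorem MomentumMap.exists_slice_section [IsManifold 𝓘(ℝ, E) ∞ M] [FiniteDimensional ℝ F]
    [FiniteDimensional ℝ E] {W : Type*} [NormedAddCommGroup W] [NormedSpace ℝ W]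
    [FiniteDimensional ℝ W] (P : MomentumMap F G Ω) {H : M → ℝ} {ξ : LieAlg F G} {x : M}
    {N : Submodule ℝ (TangentSpace 𝓘(ℝ, E) x)} (hN : P.orbitKer x ⊔ N = P.kerD x) {φ : W → M}
    (hφ : P.IsSliceParametrization x N φ)
    (hprobe : ProbeConditions fun v : W => P.augmented H ξ (φ v) - P.augmented H ξ x) :
    ∃ (Z : Submodule ℝ E) (σ : W × Z → M), σ 0 = x ∧
      ContMDiffAt 𝓘(ℝ, W × Z) 𝓘(ℝ, E) ∞ σ 0 ∧
      (∀ u : E, ∃ (η : LieAlg F G) (w : W × Z),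
        (∀ ζ, differential (E := E) (fun z => P.J z ζ) x (infAction x η) = 0) ∧
        ∃ a b : E, a = infAction (E := E) x η ∧ b = mfderiv 𝓘(ℝ, W × Z) 𝓘(ℝ, E) σ 0 w ∧
          u = a + b) ∧
      ∀ᶠ p in 𝓝 (0 : W × Z), P.J (σ p) = P.J x →
        P.augmented H ξ (σ p) ≤ P.augmented H ξ x → p = 0 := by
  obtain rfl := hφ.map_zero
  obtain ⟨L, -, hLr, hL⟩ := hφ.tangent
  replace hL : (mfderiv 𝓘(ℝ, W) 𝓘(ℝ, E) φ 0 : W →L[ℝ] E) = L := hL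
  have hK' (v : TangentSpace 𝓘(ℝ, E) (φ 0)) : v ∈ P.kerD (φ 0) ↔
      ∀ ζ, differential (E := E) (fun y => P.J y ζ) (φ 0) v = 0 := by
    rw [MomentumMap.kerD, Submodule.mem_iInf]
    rfl
  let K : Submodule ℝ E := P.kerD (φ 0)
  have hK (v : E) : v ∈ K ↔ ∀ ζ, differential (E := E) (fun y => P.J y ζ) (φ 0) v = 0 := hK' v
  let L' : W →L[ℝ] E := L
  have hsplit (k : TangentSpace 𝓘(ℝ, E) (φ 0)) (hk : k ∈ P.kerD (φ 0)) :
      ∃ (η : LieAlg F G) (t : E) (w : W), t ∈ K ∧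
        t = infAction (E := E) (φ 0) η ∧ (k : E) = t + L' w := by
    rw [← hN] at hk
    obtain ⟨t, ⟨⟨η, hη⟩, ht⟩, n, hn, hk⟩ := Submodule.mem_sup.1 hk
    rw [← hLr] at hn
    obtain ⟨w, rfl⟩ := hn
    exact ⟨η, t, w, ht, hη.symm, hk.symm⟩
  -- With Z complementary to Ker dJ(x) = T₀ + N, the derivative of `σ` covers N + Z and the group
  -- directions supply T₀.
  obtain ⟨Z, hZ⟩ := K.exists_isCompl
  obtain ⟨σ, hσ, hσφ, hσ1, hσ2⟩ := exists_thickening hφ.smooth Z.subtypeL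
  have hσ0 : σ 0 = φ 0 := hσφ.self_of_nhds
  have hlevel : ∀ᶠ w in 𝓝 (0 : W), P.J (σ (w, 0)) = P.J (φ 0) := by
    filter_upwards [hσφ, hφ.momentum] with w h1 h2
    rw [h1, h2]
  refine ⟨Z, σ, hσ0, hσ, fun u => ?_, ?_⟩
  · obtain ⟨k, hk, z, hz, rfl⟩ := Submodule.mem_sup.1 (hZ.sup_eq_top ▸ Submodule.mem_top (x := u))
    obtain ⟨η, t, w, ht, hη, hkt⟩ := hsplit k hk
    refine ⟨η, (w, ⟨z, hz⟩), fun ζ => ?_, t, L' w + z, hη, ?_, ?_⟩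
    · exact (congrArg _ hη).symm.trans ((hK t).1 ht ζ)
    · let S : W × Z →L[ℝ] E := mfderiv 𝓘(ℝ, W × Z) 𝓘(ℝ, E) σ 0
      have h1 : S (w, 0) = L' w := (hσ1 w).trans (DFunLike.congr_fun hL w)
      have h2 : S (0, ⟨z, hz⟩) = z := hσ2 _
      have h3 : S (w, ⟨z, hz⟩) = S (w, 0) + S (0, ⟨z, hz⟩) := by
        rw [← map_add, Prod.mk_add_mk, add_zero, zero_add]
      exact (h3.trans (congrArg₂ (fun a b : E => a + b) h1 h2)).symm
    · rw [hkt]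
      exact add_assoc t (L' w) z
  · have h0 := P.eventually_snd_eq_zero hσ0 hσ hlevel rfl fun z hz => by
      have h1 : (z : E) ∈ K := by
        rw [hK]
        intro ζ
        exact (congrArg _ (hσ2 z)).symm.trans (hz ζ)
      have h2 : (z : E) ∈ K ⊓ Z := ⟨h1, z.2⟩
      rw [hZ.inf_eq_bot, Submodule.mem_bot] at h2
      exact Subtype.ext h2
    have hfst := continuous_fst.tendsto (0 : W × Z)
    filter_upwards [h0, hfst.eventually hσφ, hfst.eventually hprobe.eventually_pos]
      with p h1 h2 h3 hJ hle
    have hp : p = (p.1, 0) := Prod.ext rfl (h1 hJ)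
    rw [hp, h2] at hle
    by_contra hne
    have h4 : p.1 ≠ 0 := fun h => hne (by rw [hp, h]; rfl)
    linarith [h3 h4]

end Section

/-! ### From confinement to Lyapunov stability -/

section Stability

variable {E : Type*} [NormedAddCommGroup E] [NormedSpace ℝ E]
  {M : Type*} [TopologicalSpace M] [T2Space M] [ChartedSpace E M] [IsManifold 𝓘(ℝ, E) 1 M]
  {G : Type*} [Group G] [MulAction G M]

/-- If the integral curves that start near `x` stay in the `K`-saturation of any prescribed
neighbourhood of `x`, then the trajectory through `x` is Lyapunov stable relative to `K`. -/
theorem isLyapunovStable_of_saturation {K : Set G} {X : (y : M) → TangentSpace 𝓘(ℝ, E) y}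
    (hmul : ∀ g ∈ K, ∀ h ∈ K, g * h ∈ K)
    (hG : ∀ g : G, Continuous (fun z : M => g • z))
    (hX : ContMDiff 𝓘(ℝ, E) 𝓘(ℝ, E).tangent 1 (fun y => (⟨y, X y⟩ : TangentBundle 𝓘(ℝ, E) M)))
    (hGX : ∀ (g : G) (γ : ℝ → M), IsMIntegralCurve γ X → IsMIntegralCurve (fun t => g • γ t) X)
    {x : M} (h : ∀ O ∈ 𝓝 x, ∃ U ∈ 𝓝 x, ∀ y ∈ U, ∃ γ : ℝ → M, γ 0 = y ∧ IsMIntegralCurve γ X ∧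
      ∀ t, ∃ k ∈ K, ∃ z ∈ O, γ t = k • z) :
    IsLyapunovStable K X x := by
  have huniq {γ γ' : ℝ → M} (hγ : IsMIntegralCurve γ X) (hγ' : IsMIntegralCurve γ' X)
      (h0 : γ 0 = γ' 0) : γ = γ' :=
    isMIntegralCurve_Ioo_eq_of_contMDiff_boundaryless (t₀ := 0) hX hγ hγ' h0
  obtain ⟨U₀, hU₀, hcurve⟩ := h univ univ_mem
  obtain ⟨γ₀, hγ₀0, hγ₀, -⟩ := hcurve x (mem_of_mem_nhds hU₀)
  refine ⟨γ₀, hγ₀0, hγ₀, fun V hV hVK => ?_⟩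
  have hVx : V ∈ 𝓝 x := mem_nhdsSet_iff_forall.1 hV x ⟨0, hγ₀0⟩
  obtain ⟨U, hU, hUc⟩ := h V hVx
  have hA : interior (U ∩ V) ∈ 𝓝 x := interior_mem_nhds.2 (inter_mem hU hVx)
  have hex (y : M) (k : G) (hy : k⁻¹ • y ∈ interior (U ∩ V)) : ∃ γ : ℝ → M, γ 0 = y ∧
      IsMIntegralCurve γ X ∧ ∀ t, ∃ k' ∈ K, ∃ z ∈ V, γ t = (k * k') • z := by
    obtain ⟨γ, h0, hγ, hγV⟩ := hUc _ (interior_subset hy).1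
    refine ⟨fun t => k • γ t, by simp only [h0, smul_inv_smul], hGX k γ hγ, fun t => ?_⟩
    obtain ⟨k', hk', z, hz, hγt⟩ := hγV t
    exact ⟨k', hk', z, hz, by simp only [hγt, mul_smul]⟩
  -- The saturation of an open neighbourhood of `x` whose points have trajectories confined to the
  -- saturation of V.
  refine ⟨⋃ k ∈ K, (fun y => k⁻¹ • y) ⁻¹' interior (U ∩ V), ?_, ?_, ?_, ?_, ?_, ?_⟩
  · refine iUnion₂_subset fun k hk y hy => ?_
    have h2 := hVK k hk _ (interior_subset hy).2
    rwa [smul_inv_smul] at h2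
  · exact isOpen_biUnion fun k _ => isOpen_interior.preimage (hG k⁻¹)
  · rintro _ ⟨t, rfl⟩
    -- Confinement of the trajectory of `x` itself to the saturation of `interior (U ∩ V)` puts all
    -- of γ₀ in the new set.
    obtain ⟨U', hU', hcurve'⟩ := h _ hA
    obtain ⟨γ, h0, hγ, hγt⟩ := hcurve' x (mem_of_mem_nhds hU')
    obtain ⟨k, hk, z, hz, ht⟩ := hγt t
    rw [huniq hγ hγ₀ (h0.trans hγ₀0.symm)] at ht
    refine mem_iUnion₂.2 ⟨k, hk, ?_⟩
    rw [mem_preimage, ht, inv_smul_smul]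
    exact hz
  · intro g hg y hy
    obtain ⟨k, hk, hky⟩ := mem_iUnion₂.1 hy
    refine mem_iUnion₂.2 ⟨g * k, hmul g hg k hk, ?_⟩
    rw [mem_preimage, mul_inv_rev, mul_smul, inv_smul_smul]
    exact hky
  · intro y hy
    obtain ⟨k, -, hky⟩ := mem_iUnion₂.1 hy
    obtain ⟨γ, h0, hγ, -⟩ := hex y k hky
    exact ⟨γ, h0, hγ⟩
  · intro γ hγ hγ0 t
    obtain ⟨k, hk, hky⟩ := mem_iUnion₂.1 hγ0
    obtain ⟨γ', h0, hγ', hγV⟩ := hex _ k hky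
    obtain ⟨k', hk', z, hz, ht⟩ := hγV t
    rw [← huniq hγ' hγ h0, ht]
    exact hVK _ (hmul k hk k' hk') z hz

end Stability

/-! ### Uniform coadjoint bounds and a compactness estimate -/

section Bound

variable {F : Type*} [NormedAddCommGroup F] [NormedSpace ℝ F]
  {G : Type*} [TopologicalSpace G] [ChartedSpace F G] [Group G]

/-- A pointwise bounded coadjoint action is uniformly bounded. -/
theorem exists_coAd_bound {ι : Type*} [Fintype ι] (b : Module.Basis ι ℝ (LieAlg F G)) {K : Set G}
    (hbdd : ∀ (ν : LieDual F G) (η : LieAlg F G), ∃ C : ℝ, ∀ g ∈ K, |coAd g ν η| ≤ C)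
    (η : LieAlg F G) :
    ∃ C : ℝ, ∀ g ∈ K, ∀ ν : LieDual F G, |coAd g ν η| ≤ C * ∑ l, |ν (b l)| := by
  choose c hc using fun l => hbdd (b.coord l) η
  refine ⟨∑ l, |c l|, fun g hg ν => ?_⟩
  -- Expanding ν in the dual basis leaves coefficients depending only on `g`, finitely many and each
  -- bounded on `K`.
  have h1 : coAd g ν η = ∑ l, coAd g (b.coord l) η * ν (b l) := by
    have h2 := congrArg ν (b.sum_repr (Ad (F := F) g⁻¹ η))
    rw [map_sum] at h2
    refine h2.symm.trans (Finset.sum_congr rfl fun l _ => ?_)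
    rw [map_smul]
    rfl
  rw [h1, Finset.sum_mul]
  refine (Finset.abs_sum_le_sum_abs _ _).trans (Finset.sum_le_sum fun l _ => ?_)
  rw [abs_mul]
  exact mul_le_mul ((hc l g hg).trans (le_abs_self _))
    (Finset.single_le_sum (f := fun l => |ν (b l)|) (fun _ _ => abs_nonneg _) (Finset.mem_univ l))
    (abs_nonneg _) (abs_nonneg _)

/-- On the compact set of points of the closed ball outside the small one, `u` is positive and
attains its minimum; half of it serves as δ. -/
theorem exists_forall_mem_ball_of_le {V₀ : Type*} [NormedAddCommGroup V₀] [ProperSpace V₀] {R : ℝ}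
    {u : V₀ → ℝ} (hu : ContinuousOn u (Metric.closedBall 0 R))
    (h : ∀ p ∈ Metric.closedBall 0 R, u p ≤ 0 → p = 0) {ρ : ℝ} (hρ : 0 < ρ) :
    ∃ δ > 0, ∀ p ∈ Metric.closedBall 0 R, u p ≤ δ → p ∈ Metric.ball 0 ρ := by
  have hK : IsCompact (Metric.closedBall (0 : V₀) R \ Metric.ball 0 ρ) :=
    (isCompact_closedBall 0 R).diff Metric.isOpen_ball
  obtain he | hne := (Metric.closedBall (0 : V₀) R \ Metric.ball 0 ρ).eq_empty_or_nonempty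
  · exact ⟨1, one_pos, fun p hp _ => sdiff_eq_empty.1 he hp⟩
  · obtain ⟨q, hq, hmin⟩ := hK.exists_isMinOn hne (hu.mono sdiff_subset)
    have hq0 : 0 < u q := by
      by_contra! hle
      refine hq.2 ?_
      rw [h q hq.1 hle]
      exact Metric.mem_ball_self hρ
    refine ⟨u q / 2, half_pos hq0, fun p hp hpu => ?_⟩
    by_contra hpn
    have := hmin ⟨hp, hpn⟩
    simp only [mem_ofPred_eq] at this
    linarith

end Bound

/-! ### Conservation of momentum -/

section Conservation

variable {E : Type*} [NormedAddCommGroup E] [NormedSpace ℝ E] [FiniteDimensional ℝ E]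
  {M : Type*} [TopologicalSpace M] [ChartedSpace E M]
  {F : Type*} [NormedAddCommGroup F] [NormedSpace ℝ F]
  {G : Type*} [TopologicalSpace G] [ChartedSpace F G] [Group G] [MulAction G M]
  [ContMDiffSMul 𝓘(ℝ, F) 𝓘(ℝ, E) ∞ G M] {Ω : SymplecticForm E M}

/-- Noether's theorem. -/
theorem MomentumMap.J_integralCurve (P : MomentumMap F G Ω) {H : M → ℝ}
    (hH : MDifferentiable 𝓘(ℝ, E) 𝓘(ℝ, ℝ) H) (hHG : ∀ (g : G) (y : M), H (g • y) = H y) {a b : ℝ}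
    (h0 : (0 : ℝ) ∈ Ioo a b) {γ : ℝ → M} (hγ : IsMIntegralCurveOn γ (Ω.hamVF H) (Ioo a b)) {t : ℝ}
    (ht : t ∈ Ioo a b) : P.J (γ t) = P.J (γ 0) := by
  refine LinearMap.ext fun ζ => eqOn_integralCurve_of_differential_eq_zero
    (f := fun y => P.J y ζ) ((P.smooth ζ).mdifferentiable (by simp)) (fun y => ?_) h0 hγ ht
  rw [← P.hamiltonian, form_swap, Ω.form_hamVF, differential_infAction_of_invariant hH hHG,
    neg_zero]

end Conservation

/-! ### Confinement of trajectories -/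

section SliceStability

variable {E : Type*} [NormedAddCommGroup E] [NormedSpace ℝ E] [FiniteDimensional ℝ E]
  {M : Type*} [TopologicalSpace M] [T2Space M] [ChartedSpace E M] [IsManifold 𝓘(ℝ, E) ∞ M]
  {F : Type*} [NormedAddCommGroup F] [NormedSpace ℝ F] [FiniteDimensional ℝ F]
  {G : Type*} [TopologicalSpace G] [ChartedSpace F G] [Group G]
  [MulAction G M] [ContMDiffSMul 𝓘(ℝ, F) 𝓘(ℝ, E) ∞ G M] {Ω : SymplecticForm E M}

/-- Confinement: given a section `σ` of the action of the isotropy group near `x`, for which `x` is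
isolated in the part of the level set of `J` where the augmented Hamiltonian is at most its value at
`x`, the integral curves starting near `x` exist for all time and stay in the saturation of any
prescribed neighbourhood of `x`. -/
theorem MomentumMap.exists_confined_integralCurves (P : MomentumMap F G Ω)
    (hΩ : IsSymplecticAction G Ω) {H : M → ℝ} (hH : ContMDiff 𝓘(ℝ, E) 𝓘(ℝ, ℝ) ∞ H)
    (hHG : ∀ (g : G) (y : M), H (g • y) = H y) {x : M} {ξ : LieAlg F G}
    (hbdd : ∀ (ν : LieDual F G) (η : LieAlg F G),
      ∃ C : ℝ, ∀ g ∈ P.isotropy (P.J x), |coAd g ν η| ≤ C)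
    {V₀ : Type*} [NormedAddCommGroup V₀] [NormedSpace ℝ V₀] [FiniteDimensional ℝ V₀] {σ : V₀ → M}
    (hσ0 : σ 0 = x) (hσ : ∀ᶠ p in 𝓝 (0 : V₀), ContinuousAt σ p)
    (hnhds : ∀ B ∈ 𝓝 (0 : V₀),
      {y | ∃ k ∈ P.isotropy (P.J x), ∃ p ∈ B, y = k • σ p} ∈ 𝓝 x)
    (hiso : ∀ᶠ p in 𝓝 (0 : V₀), P.J (σ p) = P.J x →
      P.augmented H ξ (σ p) ≤ P.augmented H ξ x → p = 0)
    {O : Set M} (hO : O ∈ 𝓝 x) :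
    ∃ U ∈ 𝓝 x, ∀ y ∈ U, ∃ γ : ℝ → M, γ 0 = y ∧ IsMIntegralCurve γ (Ω.hamVF H) ∧
      ∀ t, ∃ k ∈ P.isotropy (P.J x), ∃ z ∈ O, γ t = k • z := by
  have : CompleteSpace E := FiniteDimensional.complete ℝ E
  have : IsManifold 𝓘(ℝ, E) 1 M := IsManifold.of_le (n := ∞) (by norm_cast)
  have : ProperSpace V₀ := FiniteDimensional.proper ℝ V₀
  have : FiniteDimensional ℝ (LieAlg F G) := inferInstanceAs (FiniteDimensional ℝ F)
  have hHd := hH.mdifferentiable (by simp)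
  have hG (g : G) : MDifferentiable 𝓘(ℝ, E) 𝓘(ℝ, E) (fun z : M => g • z) :=
    mdifferentiable_const_smul_action F g
  have hX := Ω.contMDiff_hamVF hH
  let b := Module.finBasis ℝ (LieAlg F G)
  choose c hc using fun i => exists_coAd_bound b hbdd (b i)
  obtain ⟨c', hc'⟩ := exists_coAd_bound b hbdd ξ
  let j : M → ℝ := fun y => ∑ l, |(P.J y - P.J x) (b l)|
  have hj0 (y : M) : 0 ≤ j y := Finset.sum_nonneg fun _ _ => abs_nonneg _
  have hJc (ζ : LieAlg F G) : Continuous fun y => P.J y ζ := (P.smooth ζ).continuous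
  have hjc : Continuous j :=
    continuous_finsetSum _ fun l _ => ((hJc (b l)).sub continuous_const).abs
  have hHc : Continuous H := hH.continuous
  have hjx : j x = 0 := by simp [j]
  -- the size of `J - J x` and of the augmented Hamiltonian on an orbit of the isotropy group
  let s : M → ℝ := fun y => max ((∑ i, c i) * j y) (H y - H x + c' * j y)
  let u : M → ℝ := fun y => max (j y) (P.augmented H ξ y - P.augmented H ξ x)
  have hsx : s x = 0 := by simp [s, hjx]
  have hsc : Continuous s := (continuous_const.mul hjc).max
    ((hHc.sub continuous_const).add (continuous_const.mul hjc))
  have huc : Continuous u := hjc.max ((hHc.sub (hJc ξ)).sub continuous_const)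
  -- `s` depends on a point only through H and J, so the flow conserves it; `u` measures the point z
  -- brought back to the section. The bound is uniform in k because J(z) - μ arises from J(k·z) - μ
  -- by the bounded coadjoint action.
  have hus (k : G) (hk : k ∈ P.isotropy (P.J x)) (z : M) : u z ≤ s (k • z) := by
    have hk' := P.inv_mem_isotropy x hk
    have h1 := P.J_smul_sub x hk' (k • z)
    rw [inv_smul_smul] at h1
    refine max_le_max ?_ ?_
    · rw [Finset.sum_mul]
      refine Finset.sum_le_sum fun i _ => ?_
      rw [h1]
      exact hc i _ hk' _
    · have h2 := neg_le_of_abs_le (hc' _ hk' (P.J (k • z) - P.J x))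
      rw [← h1] at h2
      have h3 : (P.J z - P.J x) ξ = P.J z ξ - P.J x ξ := rfl
      rw [hHG]
      simp only [MomentumMap.augmented]
      change -(c' * j (k • z)) ≤ _ at h2
      linarith
  obtain ⟨R, hR, hball⟩ := Metric.nhds_basis_closedBall.eventually_iff.1 (hσ.and hiso)
  have huz : ∀ p ∈ Metric.closedBall (0 : V₀) R, u (σ p) ≤ 0 → p = 0 := by
    intro p hp hup
    have h1 : j (σ p) = 0 := le_antisymm ((le_max_left _ _).trans hup) (hj0 _)
    have h2 : P.J (σ p) - P.J x = 0 := b.ext fun l => abs_eq_zero.1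
      ((Finset.sum_eq_zero_iff_of_nonneg fun _ _ => abs_nonneg _).1 h1 l (Finset.mem_univ l))
    exact (hball hp).2 (sub_eq_zero.1 h2) (sub_nonpos.1 ((le_max_right _ _).trans hup))
  have huσ : ContinuousOn (fun p => u (σ p)) (Metric.closedBall 0 R) := fun p hp =>
    (huc.continuousAt.comp (hball hp).1).continuousWithinAt
  -- integral curves that start near `x` take a uniform time to leave the tube
  let T : Set M := {y | ∃ k ∈ P.isotropy (P.J x), ∃ p ∈ Metric.closedBall (0 : V₀) R, y = k • σ p}
  obtain ⟨ε, hε, hloc⟩ := exists_local_integralCurves (hX x)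
    (hnhds _ (Metric.closedBall_mem_nhds 0 hR))
  have hσc : Tendsto σ (𝓝 0) (𝓝 x) := by
    have h1 : ContinuousAt σ 0 := hσ.self_of_nhds
    rwa [ContinuousAt, hσ0] at h1
  -- Within radius ρ, points of the section lie in O and have integral curves that remain in T for
  -- time ε.
  obtain ⟨ρ, hρ, hρball⟩ := Metric.nhds_basis_ball.eventually_iff.1
    ((hσc.eventually hloc).and (hσc hO))
  obtain ⟨δ, hδ, hδρ⟩ := exists_forall_mem_ball_of_le huσ huz hρ
  -- Smallness of `s` forces each point of S into a translate of the ρ-ball of the section. From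
  -- there the curve stays in T for time ε, and `s` is unchanged, so it stays in S and can be
  -- restarted indefinitely.
  let S : Set M := {y | y ∈ T ∧ s y ≤ δ}
  have hSρ (y : M) (hy : y ∈ S) :
      ∃ k ∈ P.isotropy (P.J x), ∃ p ∈ Metric.ball (0 : V₀) ρ, y = k • σ p := by
    obtain ⟨⟨k, hk, p, hp, rfl⟩, hs⟩ := hy
    exact ⟨k, hk, p, hδρ p hp ((hus k hk _).trans hs), rfl⟩
  have hstep : ∀ y ∈ S, ∃ γ : ℝ → M, γ 0 = y ∧ IsMIntegralCurveOn γ (Ω.hamVF H) (Ioo (-ε) ε) ∧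
      ∀ t ∈ Ioo (-ε) ε, γ t ∈ S := by
    intro y hy
    obtain ⟨k, hk, p, hp, rfl⟩ := hSρ y hy
    obtain ⟨γ, hγ0, hγ, hγT⟩ := (hρball hp).1
    have hγ' := isMIntegralCurveOn_smul hG hΩ hHd hHG k hγ
    have h0 : (0 : ℝ) ∈ Ioo (-ε) ε := ⟨neg_lt_zero.2 hε, hε⟩
    have hγ0' : k • γ 0 = k • σ p := by rw [hγ0]
    refine ⟨fun t => k • γ t, hγ0', hγ', fun t ht => ⟨?_, ?_⟩⟩
    · obtain ⟨k', hk', p', hp', h1⟩ := hγT t ht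
      exact ⟨k * k', P.mul_mem_isotropy x hk hk', p', hp', by simp only [h1, mul_smul]⟩
    · have h1 : H (k • γ t) = H (k • γ 0) := eqOn_integralCurve_of_differential_eq_zero hHd
        (differential_self_hamVF Ω H) h0 hγ' ht
      have h2 : P.J (k • γ t) = P.J (k • γ 0) := P.J_integralCurve hHd hHG h0 hγ' ht
      have h3 : s (k • γ t) = s (k • σ p) := by
        simp only [s, j, h1, h2, hγ0]
      exact h3.trans_le hy.2
  refine ⟨S, inter_mem (hnhds _ (Metric.closedBall_mem_nhds 0 hR))
    ((hsc.tendsto x).eventually_le_const (by rwa [hsx])), fun y hy => ?_⟩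
  obtain ⟨γ, hγ0, hγ, hγS⟩ := exists_global_integralCurve hX hε hstep hy
  refine ⟨γ, hγ0, hγ, fun t => ?_⟩
  obtain ⟨k, hk, p, hp, ht⟩ := hSρ _ (hγS t)
  exact ⟨k, hk, σ p, (hρball hp).2, ht⟩

end SliceStability

end HamSym

end

/-! ### The stability theorem -/

theorem mainTheorem4
    {E : Type*} [NormedAddCommGroup E] [NormedSpace ℝ E] [FiniteDimensional ℝ E]
    {M : Type*} [TopologicalSpace M] [T2Space M] [ChartedSpace E M] [IsManifold 𝓘(ℝ, E) ∞ M]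
    {F : Type*} [NormedAddCommGroup F] [NormedSpace ℝ F] [FiniteDimensional ℝ F]
    {G : Type*} [TopologicalSpace G] [ChartedSpace F G] [Group G] [LieGroup 𝓘(ℝ, F) ∞ G]
    [MulAction G M] [ContMDiffSMul 𝓘(ℝ, F) 𝓘(ℝ, E) ∞ G M]
    {W : Type*} [NormedAddCommGroup W] [NormedSpace ℝ W]
    (Ω : HamSym.SymplecticForm E M) (hΩ : HamSym.IsSymplecticAction G Ω)
    (P : HamSym.MomentumMap F G Ω)
    (H : M → ℝ) (hH : ContMDiff 𝓘(ℝ, E) 𝓘(ℝ, ℝ) ∞ H)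
    (hHG : ∀ (g : G) (y : M), H (g • y) = H y)
    (x : M) (ξ : HamSym.LieAlg F G)
    -- `x` lies on a relative equilibrium with velocity `ξ` and finite stabilizer
    (hx : Ω.hamVF H x = HamSym.infAction x ξ)
    (hfin : (MulAction.stabilizer G x : Set G).Finite)
    -- the coadjoint action of `G_μ`, `μ = J(x)`, on `𝔤*` is bounded (as when `G_μ` is compact)
    (hbdd : ∀ (ν : HamSym.LieDual F G) (η : HamSym.LieAlg F G),
      ∃ C : ℝ, ∀ g ∈ P.isotropy (P.J x), |HamSym.coAd g ν η| ≤ C)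
    (N : Submodule ℝ (TangentSpace 𝓘(ℝ, E) x)) (hN : P.IsSymplecticSlice x N)
    (φ : W → M) (hφ : P.IsSliceParametrization x N φ)
    (hprobe : HamSym.ProbeConditions
      (fun v : W => P.augmented H ξ (φ v) - P.augmented H ξ x)) :
    HamSym.IsLyapunovStable (P.isotropy (P.J x)) (Ω.hamVF H) x := by
  have : IsManifold 𝓘(ℝ, E) 1 M := IsManifold.of_le (n := ∞) (by norm_cast)
  have := hφ.finiteDimensional
  have hG (g : G) : MDifferentiable 𝓘(ℝ, E) 𝓘(ℝ, E) (fun z : M => g • z) :=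
    HamSym.mdifferentiable_const_smul_action F g
  obtain ⟨Z, σ, hσ0, hσ, hspan, hiso⟩ := P.exists_slice_section hN.sup_eq hφ hprobe
  have hσ1 : ContMDiffAt 𝓘(ℝ, W × Z) 𝓘(ℝ, E) 1 σ 0 := hσ.of_le (by norm_cast)
  have hσc : ∀ᶠ p in 𝓝 (0 : W × Z), ContinuousAt σ p := by
    obtain ⟨u, hu, hσu⟩ := (contMDiffAt_iff_contMDiffOn_nhds (by simp)).1 hσ1
    filter_upwards [eventually_mem_nhds_iff.2 hu] with p hp
    exact hσu.continuousOn.continuousAt hp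
  refine HamSym.isLyapunovStable_of_saturation (fun _ hg _ hh => P.mul_mem_isotropy x hg hh)
    (fun g => (hG g).continuous) (Ω.contMDiff_hamVF hH) (fun g γ hγ => ?_) fun O hO =>
      P.exists_confined_integralCurves hΩ hH hHG hbdd hσ0 hσc
        (fun B hB => P.isotropy_smul_mem_nhds x hσ0 hσ1 hspan hB) hiso hO
  exact isMIntegralCurve_iff_isMIntegralCurveOn.2 (HamSym.isMIntegralCurveOn_smul hG hΩ
    (hH.mdifferentiable (by simp)) hHG g (hγ.isMIntegralCurveOn univ))
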